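/- Let $R$ be a commutative unital $\mathbb{Q}$-algebra, $n\ge 0$, and let $G=(G_1,\dots,G_n)$ be formal power series in $n$ variables over $R$, with tensor elements $G^{[p]}_{i,j_1\dots j_p}=\left.\frac{\partial^p G_i}{\partial X_{j_1}\cdots\partial X_{j_p}}\right|_{X=0}$, $p\ge 0$. A family in $R[[X]]=R[[X_1,\dots,X_n]]$ is called summable if every monomial has a nonzero coefficient in only finitely many of its members; its sum is then taken coefficientwise. *Diagrams.* A Feynman diagram structure $\mathcal F$ of type $([1],\emptyset)$ on a finite set $E$ (of half-lines) consists of two decompositions into disjoint subsets $E=E_{\bar u}\sqcup E_u=E_{int}\sqcup E_{ext}$ such that $E_{ext}\cap E_{\bar u}=\emptyset$ and $E_{ext}\cap E_u$ is a singleton (the root), a partition $\pi$ of $E_{int}$ into blocks (vertices) each containing exactly one element of $E_{\bar u}$ and any number, possibly zero, of elements of $E_u$, and a bijection $\mathcal C:E_{\bar u}\to E_u$. It is connected if the graph whose vertices are the blocks of $\pi$ and the root singleton, with a link from $a$ to $b$ whenever $\mathcal C(x)\in b$ for some $x\in a\cap E_{\bar u}$, is connected (orientations being forgotten). Isomorphisms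 are bijections of the underlying sets that transport all the data, and $\mathrm{Aut}(E,\mathcal F)$ is the group of automorphisms. The amplitude $\mathcal A_i(E,\mathcal F)\in R[[X]]$ is the sum, over all maps $\alpha:E\to\{1,\dots,n\}$ taking the value $i$ at the root, of the product of the factors $\delta_{\alpha(\mathcal C(x))\alpha(x)}$ for $x\in E_{\bar u}$ and of the factors $X_{\alpha(\bar x)}G^{[p]}_{\alpha(\bar x),\alpha(y_1)\dots\alpha(y_p)}$ for the blocks $B\in\pi$, where $B\cap E_{\bar u}=\{\bar x\}$ and $B\cap E_u=\{y_1,\dots,y_p\}$. The connected 1-point function is $$\langle u_i\rangle_C=\sum_{[E,\mathcal F]\ \mathrm{connected}}\frac{\mathcal A_i(E,\mathcal F)}{\#\mathrm{Aut}(E,\mathcal F)},$$ the sum being over isomorphism classes of connected diagrams of type $([1],\emptyset)$. *Formal Gaussian integrals.* For maps $\tau_1:[k_1]\to[n]$ and $\tau_2:[k_2]\to[n]$ put $\int d\bar u\,du\,e^{-\bar u u}\prod_k\bar u_{\tau_1(k)}\prod_k u_{\tau_2(k)}=\sum_\sigma\prod_{k}\delta_{\tau_2(\sigma(k))\tau_1(k)}$,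 the sum being over all bijections $\sigma:[k_1]\to[k_2]$ (so that it is $0$ if $k_1\neq k_2$). Extend this $R[[X]]$-linearly, monomial by monomial, to those $U\in R[[\bar u,u,X]]$ for which the resulting family in $R[[X]]$ is summable. Write $\bar uXG(u)=\sum_{i}\bar u_iX_iG_i(u)$. Then the families defining $\langle u_i\rangle_C$, $1\le i\le n$, are summable, and the series $F_i(X):=\langle u_i\rangle_C$ have no constant term and satisfy $$F_i(X)=X_i\,G_i(F(X)),\qquad 1\le i\le n.$$ Moreover $F=(F_1,\dots,F_n)$ is the only system of series in $R[[X]]$ without constant term that satisfies these equations. Finally the formal Gaussian integrals below are defined (their families are summable), the denominator is invertible in $R[[X]]$, and $$F_i(X)=\frac{\int d\bar u\,du\;e^{-\bar u u}\,u_i\,e^{\bar uXG(u)}}{\int d\bar u\,du\;e^{-\bar u u}\,e^{\bar uXG(u)}},\qquad 1\le i\le n.$$ -/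

import Mathlib

namespace LagrangeGood

open MvPowerSeries

/-! ### Summable families of formal power series -/

section Families

variable {R σ ι : Type*} [CommRing R]

/-- A family of formal power series is summable (for the product topology, the coefficient ring
being discrete) when each monomial occurs with a nonzero coefficient in only finitely many
members. -/
def SummableFamily (f : ι → MvPowerSeries σ R) : Prop :=
  ∀ m : σ →₀ ℕ, {a : ι | coeff m (f a) ≠ 0}.Finite

/-- The sum of a summable family, computed coefficient by coefficient (each coefficient is a sum
with finite support). -/
noncomputable def familySum (f : ι → MvPowerSeries σ R) : MvPowerSeries σ R :=
  fun m => ∑ᶠ a : ι, coeff m (f a)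

end Families

/-! ### Tensor elements of a power series -/

/-- The tensor element `f^{[p]}_{j₁…j_p}`, i.e. the value at `0` of
`∂^p f / ∂X_{j₁} ⋯ ∂X_{j_p}`, where `(j₁, …, j_p)` is the family `(α y)_{y ∈ s}`, `p = #s`.
It equals `μ! · [X^μ] f`, where `μ` is the multiindex of multiplicities of the family, and
so depends only on the unordered family. -/
noncomputable def tensorElement {R E : Type*} [CommRing R] {n : ℕ}
    (f : MvPowerSeries (Fin n) R) (s : Finset E) (α : E → Fin n) : R :=
  let μ : Fin n →₀ ℕ := ∑ y ∈ s, Finsupp.single (α y) 1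
  ((∏ i, (μ i).factorial : ℕ) : R) * coeff μ f

/-! ### Feynman diagram structures -/

/-- A pre-Feynman diagram structure of type `(I, J)` on a finite set `E` of half-lines, with
only one kind of vertices (the `XG`-vertices). -/
structure PreFeynmanDiagram (I J E : Type*) [Fintype E] [DecidableEq E] where
  /-- half-lines of type `ū` -/
  uBar : Finset E
  /-- half-lines of type `u` -/
  u : Finset E
  /-- internal half-lines -/
  int : Finset E
  /-- external half-lines -/
  ext : Finset E
  /-- the set of `XG`-vertices -/
  vertices : Finset (Finset E)
  /-- the labelling of the external `u` half-lines -/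
  rhoU : I → E
  /-- the labelling of the external `ū` half-lines -/
  rhoUBar : J → E
  disjoint_uBar_u : Disjoint uBar u
  union_uBar_u : uBar ∪ u = Finset.univ
  disjoint_int_ext : Disjoint int ext
  union_int_ext : int ∪ ext = Finset.univ
  bijOn_rhoU : Set.BijOn rhoU Set.univ (↑(ext ∩ u) : Set E)
  bijOn_rhoUBar : Set.BijOn rhoUBar Set.univ (↑(ext ∩ uBar) : Set E)
  empty_notMem_vertices : ∅ ∉ vertices
  pairwiseDisjoint_vertices : (↑vertices : Set (Finset E)).PairwiseDisjoint id
  sup_vertices : vertices.sup id = int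
  card_vertex_uBar : ∀ B ∈ vertices, (B ∩ uBar).card = 1

/-- A Feynman diagram structure: a pre-Feynman diagram structure together with a contraction
scheme, that is a bijection from the `ū` half-lines to the `u` half-lines. -/
structure FeynmanDiagram (I J E : Type*) [Fintype E] [DecidableEq E] extends
    PreFeynmanDiagram I J E where
  contraction : {x // x ∈ uBar} ≃ {x // x ∈ u}

namespace FeynmanDiagram

theorem map_symm_of_map {E E' : Type*} {σ : E ≃ E'} {s : Finset E} {t : Finset E'}
    (h : s.map σ.toEmbedding = t) : t.map σ.symm.toEmbedding = s := by
  subst h; ext; simp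

variable {I J : Type*} {E E' E'' : Type*} [Fintype E] [DecidableEq E] [Fintype E']
  [DecidableEq E'] [Fintype E''] [DecidableEq E'']

/-- The transport of structure along the bijection `σ : E ≃ E'` sends `D` to `D'`. -/
structure IsIso (σ : E ≃ E') (D : FeynmanDiagram I J E) (D' : FeynmanDiagram I J E') :
    Prop where
  uBar : D.uBar.map σ.toEmbedding = D'.uBar
  u : D.u.map σ.toEmbedding = D'.u
  int : D.int.map σ.toEmbedding = D'.int
  ext : D.ext.map σ.toEmbedding = D'.ext
  vertices : D.vertices.map (Finset.mapEmbedding σ.toEmbedding).toEmbedding = D'.vertices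
  rhoU : ∀ a, σ (D.rhoU a) = D'.rhoU a
  rhoUBar : ∀ b, σ (D.rhoUBar b) = D'.rhoUBar b
  contraction : ∀ (x : E) (hx : x ∈ D.uBar) (hx' : σ x ∈ D'.uBar),
    σ (D.contraction ⟨x, hx⟩) = D'.contraction ⟨σ x, hx'⟩

/-- The set of automorphisms of a diagram. -/
def Aut (D : FeynmanDiagram I J E) : Set (Equiv.Perm E) := {σ | IsIso σ D D}

/-- The vertices of the digraph associated with a diagram: the `XG`-vertices and the
one-element sets of external half-lines. They form a partition of `E`. -/
def cells (D : FeynmanDiagram I J E) : Finset (Finset E) :=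
  D.vertices ∪ D.ext.image (fun x => {x})

/-- The links of the digraph: `a → b` when some `ū` half-line of `a` is contracted with a
`u` half-line of `b`. -/
def Link (D : FeynmanDiagram I J E) (a b : {c // c ∈ D.cells}) : Prop :=
  ∃ x : {x // x ∈ D.uBar}, (x : E) ∈ a.1 ∧ (D.contraction x : E) ∈ b.1

/-- A diagram is connected when its digraph is connected (orientations being forgotten). -/
def Connected (D : FeynmanDiagram I J E) : Prop :=
  (SimpleGraph.fromRel D.Link).Connected

section Amplitude

variable {R : Type*} [CommRing R] {n : ℕ}

/-- The index attributions: all `α : E → [n]` compatible with the assignment maps on the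
external half-lines. -/
def IsIndexAttribution (D : FeynmanDiagram I J E) (τu : I → Fin n) (τuBar : J → Fin n)
    (α : E → Fin n) : Prop :=
  (∀ a, α (D.rhoU a) = τu a) ∧ ∀ b, α (D.rhoUBar b) = τuBar b

/-- The factor `X_i G^{[p]}_{i, j₁…j_p}` of an `XG`-vertex `B`, where `i` is the index of the
unique `ū` half-line of `B` (the outer product has exactly one factor) and `j₁, …, j_p` are the
indices of its `u` half-lines. -/
noncomputable def vertexFactor (D : FeynmanDiagram I J E)
    (G : Fin n → MvPowerSeries (Fin n) R) (α : E → Fin n) (B : Finset E) :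
    MvPowerSeries (Fin n) R :=
  ∏ x ∈ B ∩ D.uBar, X (α x) * C (tensorElement (G (α x)) (B ∩ D.u) α)

open Classical in
/-- The amplitude of a diagram: the sum over index attributions of the product of a Kronecker
symbol for each contraction line and of the factors of the vertices. -/
noncomputable def amplitude (D : FeynmanDiagram I J E) (G : Fin n → MvPowerSeries (Fin n) R)
    (τu : I → Fin n) (τuBar : J → Fin n) : MvPowerSeries (Fin n) R :=
  ∑ α : E → Fin n with D.IsIndexAttribution τu τuBar α,
    (∏ x : {x // x ∈ D.uBar}, if α (D.contraction x) = α x then 1 else 0) *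
      ∏ B ∈ D.vertices, D.vertexFactor G α B

end Amplitude

theorem IsIso.refl (D : FeynmanDiagram I J E) : IsIso (Equiv.refl E) D D where
  uBar := by ext; simp
  u := by ext; simp
  int := by ext; simp
  ext := by ext; simp
  vertices := by
    have : Finset.mapEmbedding (Equiv.refl E).toEmbedding = RelEmbedding.refl _ := by
      ext s x; simp
    rw [this]; ext; simp
  rhoU _ := rfl
  rhoUBar _ := rfl
  contraction _ _ _ := rfl

theorem IsIso.symm {σ : E ≃ E'} {D : FeynmanDiagram I J E} {D' : FeynmanDiagram I J E'}
    (h : IsIso σ D D') : IsIso σ.symm D' D where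
  uBar := map_symm_of_map h.uBar
  u := map_symm_of_map h.u
  int := map_symm_of_map h.int
  ext := map_symm_of_map h.ext
  vertices := by
    rw [← h.vertices, Finset.map_map]
    convert Finset.map_refl
    ext s x; simp
  rhoU a := by rw [← h.rhoU, Equiv.symm_apply_apply]
  rhoUBar a := by rw [← h.rhoUBar, Equiv.symm_apply_apply]
  contraction x hx hx' := by
    have := h.contraction (σ.symm x) hx' (by simpa using hx)
    simp only [Equiv.apply_symm_apply] at this
    rw [← this, Equiv.symm_apply_apply]

theorem IsIso.trans {σ : E ≃ E'} {τ : E' ≃ E''} {D : FeynmanDiagram I J E}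
    {D' : FeynmanDiagram I J E'} {D'' : FeynmanDiagram I J E''}
    (h : IsIso σ D D') (h' : IsIso τ D' D'') : IsIso (σ.trans τ) D D'' where
  uBar := by rw [← h'.uBar, ← h.uBar, Finset.map_map]; rfl
  u := by rw [← h'.u, ← h.u, Finset.map_map]; rfl
  int := by rw [← h'.int, ← h.int, Finset.map_map]; rfl
  ext := by rw [← h'.ext, ← h.ext, Finset.map_map]; rfl
  vertices := by
    rw [← h'.vertices, ← h.vertices, Finset.map_map]
    congr 1
    refine DFunLike.ext _ _ fun s => ?_
    simp [Finset.map_map]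
  rhoU a := by simp [h.rhoU, h'.rhoU]
  rhoUBar a := by simp [h.rhoUBar, h'.rhoUBar]
  contraction x hx hx' := by
    have hm : σ x ∈ D'.uBar := by rw [← h.uBar]; simpa using hx
    simp only [Equiv.trans_apply]
    rw [h.contraction x hx hm, h'.contraction (σ x) hm hx']

theorem IsIso.card_aut_eq {σ : E ≃ E'} {D : FeynmanDiagram I J E}
    {D' : FeynmanDiagram I J E'} (h : IsIso σ D D') : Nat.card D.Aut = Nat.card D'.Aut := by
  refine Nat.card_congr ((σ.permCongr).subtypeEquiv fun τ => ⟨fun hτ => ?_, fun hτ => ?_⟩)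
  · exact (h.symm.trans hτ).trans h
  · have := (h.trans hτ).trans h.symm
    have e : (σ.trans (σ.permCongr τ)).trans σ.symm = τ := by ext x; simp
    rwa [e] at this

theorem IsIso.amplitude_eq {R : Type*} [CommRing R] {n : ℕ} {σ : E ≃ E'}
    {D : FeynmanDiagram I J E} {D' : FeynmanDiagram I J E'} (h : IsIso σ D D')
    (G : Fin n → MvPowerSeries (Fin n) R) (τu : I → Fin n) (τuBar : J → Fin n) :
    D.amplitude G τu τuBar = D'.amplitude G τu τuBar := by
  classical
  unfold amplitude
  refine Finset.sum_equiv (σ.arrowCongr (Equiv.refl _)) (fun α => ?_) (fun α _ => ?_)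
  · simp only [Finset.mem_filter, Finset.mem_univ, true_and]
    simp [IsIndexAttribution, ← h.rhoU, ← h.rhoUBar]
  · have hmem : ∀ x, x ∈ D.uBar ↔ σ x ∈ D'.uBar := fun x => by rw [← h.uBar]; simp
    congr 1
    · refine Fintype.prod_equiv (σ.subtypeEquiv hmem) _ _ fun x => ?_
      have := h.contraction x.1 x.2 ((hmem _).1 x.2)
      simp [Equiv.subtypeEquiv, ← this]
    · rw [← h.vertices, Finset.prod_map]
      refine Finset.prod_congr rfl fun B _ => ?_
      have e1 : B.map σ.toEmbedding ∩ D'.uBar = (B ∩ D.uBar).map σ.toEmbedding := by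
        rw [← h.uBar, Finset.map_inter]
      have e2 : B.map σ.toEmbedding ∩ D'.u = (B ∩ D.u).map σ.toEmbedding := by
        rw [← h.u, Finset.map_inter]
      simp [vertexFactor, e1, e2, tensorElement]

end FeynmanDiagram

/-! ### Isomorphism classes of connected diagrams and the connected 1-point function -/

section Classes

variable (I J : Type*)

/-- Connected Feynman diagram structures of type `(I, J)` on the finite sets `{0, …, k - 1}`. -/
abbrev ConnectedDiagram := Σ k : ℕ, {D : FeynmanDiagram I J (Fin k) // D.Connected}

/-- Two diagrams are equivalent when a bijection transports one to the other. -/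
instance connectedDiagramSetoid : Setoid (ConnectedDiagram I J) where
  r D D' := ∃ σ : Fin D.1 ≃ Fin D'.1, FeynmanDiagram.IsIso σ D.2.1 D'.2.1
  iseqv :=
    ⟨fun D => ⟨_, FeynmanDiagram.IsIso.refl D.2.1⟩, fun ⟨_, h⟩ => ⟨_, h.symm⟩,
      fun ⟨_, h⟩ ⟨_, h'⟩ => ⟨_, h.trans h'⟩⟩

/-- The set of isomorphism classes `[E, 𝓕]` of connected diagrams of type `(I, J)`. Every finite
set is in bijection with some `{0, …, k - 1}`, so this is the set of classes over all finite
sets. -/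
abbrev DiagramClass := Quotient (connectedDiagramSetoid I J)

variable {I J} {R : Type*} [CommRing R] [Algebra ℚ R] {n : ℕ}

/-- The contribution `𝓐(E, 𝓕) / #Aut(E, 𝓕)` of a class of diagrams. -/
noncomputable def classWeight (G : Fin n → MvPowerSeries (Fin n) R) (τu : I → Fin n)
    (τuBar : J → Fin n) : DiagramClass I J → MvPowerSeries (Fin n) R :=
  Quotient.lift
    (fun D : ConnectedDiagram I J =>
      ((Nat.card D.2.1.Aut : ℚ)⁻¹) • D.2.1.amplitude G τu τuBar)
    (by
      rintro D D' ⟨σ, h⟩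
      simp only [h.card_aut_eq, h.amplitude_eq])

/-- The family of contributions to the connected 1-point function: diagrams of type
`([1], ∅)`, the external half-line being assigned the index `i`. -/
noncomputable def onePointWeight (G : Fin n → MvPowerSeries (Fin n) R) (i : Fin n) :
    DiagramClass (Fin 1) (Fin 0) → MvPowerSeries (Fin n) R :=
  classWeight G (fun _ => i) Fin.elim0

/-- The connected 1-point function `⟨u_i⟩_C`. -/
noncomputable def connectedOnePoint (G : Fin n → MvPowerSeries (Fin n) R) (i : Fin n) :
    MvPowerSeries (Fin n) R :=
  familySum (onePointWeight G i)

end Classes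

/-! ### Formal Gaussian integration -/

/-- The indeterminates `ū_i`, `u_i`, `X_i`. -/
inductive Var (n : ℕ) where
  | uBar (i : Fin n)
  | u (i : Fin n)
  | x (i : Fin n)

section Gaussian

variable {R : Type*} [CommRing R] {n : ℕ}

/-- The formal Gaussian integral `∫ dū du e^{-ūAu} ū^a u^b` of a monomial, i.e.
`(det A)⁻¹ ∑_σ ∏_k (A⁻¹)_{τ₂(σ k), τ₁(k)}`, with `σ` running over the bijections between the index
sets of two families `τ₁`, `τ₂` of elements of `[n]` of multiplicities `a`, `b`. Here
the families used are the first projections of `Σ i, Fin (a i)` and `Σ i, Fin (b i)`. -/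
noncomputable def gaussianMonomial (A : Matrix.GeneralLinearGroup (Fin n) R)
    (a b : Fin n → ℕ) : R :=
  (((Matrix.GeneralLinearGroup.det A)⁻¹ : Rˣ) : R) *
    ∑ σ : (Σ i, Fin (a i)) ≃ (Σ i, Fin (b i)),
      ∏ k, ((A⁻¹ : Matrix.GeneralLinearGroup (Fin n) R) : Matrix (Fin n) (Fin n) R) (σ k).1 k.1

/-- The contribution to the formal Gaussian integral of `U ∈ R[[ū, u, X]]` of the monomial with
exponent `m`; the variables `X` are not integrated over. -/
noncomputable def gaussianTerm (A : Matrix.GeneralLinearGroup (Fin n) R)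
    (U : MvPowerSeries (Var n) R) (m : Var n →₀ ℕ) : MvPowerSeries (Fin n) R :=
  monomial (Finsupp.equivFunOnFinite.symm fun i => m (Var.x i))
    (coeff m U * gaussianMonomial A (fun i => m (Var.uBar i)) (fun i => m (Var.u i)))

/-- The formal Gaussian integral of `U` with covariance `A⁻¹` is defined. -/
def GaussianSummable (A : Matrix.GeneralLinearGroup (Fin n) R) (U : MvPowerSeries (Var n) R) :
    Prop :=
  SummableFamily (gaussianTerm A U)

/-- The formal Gaussian integral `∫ dū du e^{-ūAu} U ∈ R[[X]]`. -/
noncomputable def gaussianIntegral (A : Matrix.GeneralLinearGroup (Fin n) R)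
    (U : MvPowerSeries (Var n) R) : MvPowerSeries (Fin n) R :=
  familySum (gaussianTerm A U)

/-- The interaction `ūXG(u) = ∑ᵢ ū_i X_i G_i(u)` in `R[[ū, u, X]]`. -/
noncomputable def interaction (G : Fin n → MvPowerSeries (Fin n) R) : MvPowerSeries (Var n) R :=
  ∑ i, X (Var.uBar i) * X (Var.x i) * (G i).subst (fun j => (X (Var.u j) : MvPowerSeries (Var n) R))

/-- The series `e^{ūXG(u)}` in `R[[ū, u, X]]`. -/
noncomputable def expInteraction [Algebra ℚ R] (G : Fin n → MvPowerSeries (Fin n) R) :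
    MvPowerSeries (Var n) R :=
  (PowerSeries.exp R).subst (interaction G)

end Gaussian

end LagrangeGood

namespace LagrangeGood

open MvPowerSeries

/-! ### Linear recursion satisfied by the powers of a solution -/

section Branching

variable {R : Type*} [CommRing R] {n : ℕ}

/-! The nonlinear system is replaced by a linear one. For a solution F, the powers F^m = ∏ F_i^{m_i}
satisfy K (m + e_i) = X_i ∑_b G_{i,b} K (m + b), and X^m divides K m; this is `IsBranching`. The
recursion expresses each coefficient of K (m + e_i) through coefficients of total degree one less,
and the divisibility makes the sums finite, so K is determined by K 0. Multiplication by a series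
preserves the two properties, hence K m = K 0 * L m as soon as L 0 = 1 (`IsBranching.eq_mul`).
Applied to the shifts of K, this shows that a family with K 0 = 1 is multiplicative in m; it
therefore consists of the powers of the series K e_i, and these solve F_i = X_i G_i(F).

Three branching families are compared: the powers of an arbitrary solution (`isBranching_of_eq`);
the integrals of u^p e^{ūXG(u)} (`isBranching_gaussianIntegral`), whose value at 0 is the
denominator; and m! times the exponential generating series of labelled forests with root
multiplicities m (`isBranching_forestSeries`), whose value at 0 is 1. The recursion for forests
consists in deleting a root, so that its children become roots. The comparison yields existence,
uniqueness and the quotient of integrals at once.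

It remains to identify ⟨u_i⟩_C with the forest series at e_i. Every diagram of type ([1], ∅) comes
from a parent map with one root: the `ū` half-line of a vertex is contracted with a `u` half-line of
its parent. The diagram is connected exactly when that map is a tree, isomorphisms are relabellings
of vertices, and by orbit-stabilizer the weights 1/#Aut sum classes as 1/N! sums labelled trees
(`connectedOnePoint_eq_forestSeries`). -/

/-- Families `K` of series such that `X^m ∣ K m` and `K (m + e_i) = X_i ∑_b G_{i,b} K (m + b)`,
`G_{i,b}` being the coefficients of `G_i`. The powers `F^m` of a solution of `F_i = X_i G_i(F)`
form such a family. -/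
structure IsBranching (G : Fin n → MvPowerSeries (Fin n) R)
    (K : (Fin n →₀ ℕ) → MvPowerSeries (Fin n) R) : Prop where
  coeff_eq_zero : ∀ m c, ¬ m ≤ c → coeff c (K m) = 0
  step : ∀ m i c, coeff (c + Finsupp.single i 1) (K (m + Finsupp.single i 1)) =
    ∑ b ∈ Finset.Icc 0 c, coeff b (G i) * coeff c (K (m + b))

/-- The series `∑_b G_{i,b} K (m + b)`, for a family `K` such that `X^m ∣ K m`. -/
noncomputable def branchingSum (G : Fin n → MvPowerSeries (Fin n) R)
    (K : (Fin n →₀ ℕ) → MvPowerSeries (Fin n) R) (m : Fin n →₀ ℕ) (i : Fin n) :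
    MvPowerSeries (Fin n) R :=
  fun c => ∑ b ∈ Finset.Icc 0 c, coeff b (G i) * coeff c (K (m + b))

theorem coeff_add_single_X_mul (c : Fin n →₀ ℕ) (i : Fin n) (f : MvPowerSeries (Fin n) R) :
    coeff (c + Finsupp.single i 1) (X i * f) = coeff c f := by
  rw [add_comm, X, coeff_add_monomial_mul, one_mul]

theorem coeff_X_mul_eq_zero {c : Fin n →₀ ℕ} {i : Fin n} (h : c i = 0)
    (f : MvPowerSeries (Fin n) R) : coeff c (X i * f) = 0 := by
  rw [X, coeff_monomial_mul, if_neg]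
  intro h'
  simpa [h] using h' i

theorem eq_add_single {m : Fin n →₀ ℕ} {i : Fin n} (h : m i ≠ 0) :
    ∃ m', m = m' + Finsupp.single i 1 := by
  refine ⟨m - Finsupp.single i 1, (tsub_add_cancel_of_le ?_).symm⟩
  rw [Finsupp.single_le_iff]
  omega

namespace IsBranching

variable {G : Fin n → MvPowerSeries (Fin n) R} {K L : (Fin n →₀ ℕ) → MvPowerSeries (Fin n) R}

/-- Uniqueness, by induction on the degree of the exponent c, for all m at once: the recursion
lowers this degree by one but replaces m by arbitrarily larger m' + b. If the chosen i with m i ≠ 0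
has c i = 0, divisibility by X^m gives the vanishing instead. -/
theorem eq_zero (hK : IsBranching G K) (h0 : K 0 = 0) (m : Fin n →₀ ℕ) : K m = 0 := by
  suffices ∀ d c, c.degree = d → ∀ m, coeff c (K m) = 0 by
    ext c; simpa using this _ c rfl m
  intro d
  induction d with
  | zero =>
    intro c hc m
    by_cases hm : m = 0
    · simp [hm, h0]
    · refine hK.coeff_eq_zero _ _ fun h => hm ?_
      rw [Finsupp.degree_eq_zero_iff] at hc
      simpa [hc] using h
  | succ d ih =>
    intro c hc m
    by_cases hm : m = 0
    · simp [hm, h0]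
    obtain ⟨i, hi⟩ := DFunLike.ne_iff.1 hm
    obtain ⟨m', rfl⟩ := eq_add_single hi
    by_cases hci : c i = 0
    · refine hK.coeff_eq_zero _ _ fun h => hi ?_
      have := h i
      rw [hci] at this
      simp at this
    obtain ⟨c', rfl⟩ := eq_add_single hci
    rw [hK.step]
    refine Finset.sum_eq_zero fun b _ => ?_
    rw [ih c' (by simpa using hc), mul_zero]

theorem sub (hK : IsBranching G K) (hL : IsBranching G L) :
    IsBranching G (fun m => K m - L m) where
  coeff_eq_zero m c h := by simp [hK.coeff_eq_zero m c h, hL.coeff_eq_zero m c h]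
  step m i c := by simp [hK.step, hL.step, mul_sub]

theorem shift (hK : IsBranching G K) (m' : Fin n →₀ ℕ) : IsBranching G (fun m => K (m' + m)) where
  coeff_eq_zero m c h := hK.coeff_eq_zero _ _ fun h' => h (le_trans le_add_self h')
  step m i c := by simp only [← add_assoc, hK.step]

theorem eq_X_mul (hK : IsBranching G K) (m : Fin n →₀ ℕ) (i : Fin n) :
    K (m + Finsupp.single i 1) =
      X i * branchingSum G K m i := by
  ext c
  by_cases hci : c i = 0
  · rw [coeff_X_mul_eq_zero hci, hK.coeff_eq_zero]
    intro h
    simpa [hci] using h i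
  · obtain ⟨c, rfl⟩ := eq_add_single hci
    rw [coeff_add_single_X_mul, hK.step]
    rfl

/-- In a sum over the exponents `b ≤ q` of a branching family, the bound may be raised. -/
theorem sum_Icc_eq (h0 : ∀ m c, ¬ m ≤ c → coeff c (K m) = 0) {q c : Fin n →₀ ℕ} (hq : q ≤ c)
    (i : Fin n) (m : Fin n →₀ ℕ) :
    ∑ b ∈ Finset.Icc 0 q, coeff b (G i) * coeff q (K (m + b)) =
      ∑ b ∈ Finset.Icc 0 c, coeff b (G i) * coeff q (K (m + b)) := by
  refine Finset.sum_subset (Finset.Icc_subset_Icc_right hq) fun b _ hb => ?_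
  rw [h0, mul_zero]
  intro h
  exact hb (by simpa using le_trans le_add_self h)

theorem mul_left (hK : IsBranching G K) (s : MvPowerSeries (Fin n) R) :
    IsBranching G (fun m => s * K m) where
  coeff_eq_zero m c h := by
    rw [coeff_mul]
    refine Finset.sum_eq_zero fun p hp => ?_
    rw [hK.coeff_eq_zero, mul_zero]
    intro h'
    rw [Finset.HasAntidiagonal.mem_antidiagonal] at hp
    exact h (h'.trans (hp ▸ le_add_self))
  step m i c := by
    rw [hK.eq_X_mul, mul_left_comm, coeff_add_single_X_mul, coeff_mul]
    simp only [coeff_mul, Finset.mul_sum]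
    rw [Finset.sum_comm]
    refine Finset.sum_congr rfl fun p hp => ?_
    rw [Finset.HasAntidiagonal.mem_antidiagonal] at hp
    change _ * ∑ b ∈ Finset.Icc 0 p.2, coeff b (G i) * coeff p.2 (K (m + b)) = _
    -- The range of b must not depend on the antidiagonal pair, so that the two sums can be
    -- exchanged.
    rw [sum_Icc_eq hK.coeff_eq_zero (hp ▸ le_add_self : p.2 ≤ c), Finset.mul_sum]
    exact Finset.sum_congr rfl fun b _ => by ring

/-- K and K 0 * L are branching families with the same value at 0, so their difference vanishes. -/
theorem eq_mul (hK : IsBranching G K) (hL : IsBranching G L) (h0 : L 0 = 1)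
    (m : Fin n →₀ ℕ) : K m = K 0 * L m :=
  sub_eq_zero.1 ((hK.sub (hL.mul_left (K 0))).eq_zero (by simp [h0]) m)

/-- The shifted family K (m + ·) is branching with value K m at 0; compare it with K itself. -/
theorem map_add (hK : IsBranching G K) (h0 : K 0 = 1) (m m' : Fin n →₀ ℕ) :
    K (m + m') = K m * K m' := by
  simpa using (hK.shift m).eq_mul hK h0 m'

theorem eq_prod (hK : IsBranching G K) (h0 : K 0 = 1) (m : Fin n →₀ ℕ) :
    K m = m.prod fun i k => K (Finsupp.single i 1) ^ k := by
  induction m using Finsupp.induction_linear with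
  | zero => simpa using h0
  | add m m' h h' =>
    rw [hK.map_add h0, h, h', Finsupp.prod_add_index' (by simp) (fun _ _ _ => pow_add _ _ _)]
  | single i k =>
    rw [Finsupp.prod_single_index (by simp)]
    induction k with
    | zero => simpa using h0
    | succ k ih => rw [Finsupp.single_add, hK.map_add h0, ih, pow_succ]

theorem constantCoeff_single (hK : IsBranching G K) (i : Fin n) :
    constantCoeff (K (Finsupp.single i 1)) = 0 := by
  rw [← coeff_zero_eq_constantCoeff_apply]
  refine hK.coeff_eq_zero _ _ fun h => ?_
  simpa using h i

/-- The recursion at m = 0 reads K e_i = X_i ∑_b G_{i,b} K b, and multiplicativity turns K b into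
the monomial of exponent b in the series K e_j: the sum is the substitution. Divisibility of K b by
X^b cuts it down to b ≤ c in each coefficient. -/
theorem single_eq_X_mul_subst (hK : IsBranching G K) (h0 : K 0 = 1) (i : Fin n) :
    K (Finsupp.single i 1) = X i * (G i).subst (fun j => K (Finsupp.single j 1)) := by
  have := hK.eq_X_mul 0 i
  rw [zero_add] at this
  rw [this]
  congr 1
  ext c
  rw [coeff_subst (hasSubst_of_constantCoeff_zero hK.constantCoeff_single),
    finsum_eq_sum_of_support_subset (s := Finset.Icc 0 c)]
  · change ∑ b ∈ Finset.Icc 0 c, coeff b (G i) * coeff c (K (0 + b)) = _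
    refine Finset.sum_congr rfl fun b _ => ?_
    rw [zero_add, hK.eq_prod h0, smul_eq_mul]
  · intro b hb
    by_contra hbc
    refine hb ?_
    dsimp only
    rw [← hK.eq_prod h0, hK.coeff_eq_zero _ _ (by simpa using hbc), smul_zero]

end IsBranching

theorem coeff_prod_pow_eq_zero {F H : Fin n → MvPowerSeries (Fin n) R}
    (h : ∀ i, F i = X i * H i) (m c : Fin n →₀ ℕ) (hmc : ¬ m ≤ c) :
    coeff c (m.prod fun i k => F i ^ k) = 0 := by
  simp only [h, mul_pow]
  have := monomial_one_eq (R := R) m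
  rw [Finsupp.prod_mul, ← this, coeff_monomial_mul, if_neg hmc]

/-- Multiply F_i = X_i G_i(F) by F^m and expand G_i(F) in powers of F. -/
theorem isBranching_of_eq {G F : Fin n → MvPowerSeries (Fin n) R}
    (h0 : ∀ i, constantCoeff (F i) = 0) (h : ∀ i, F i = X i * (G i).subst F) :
    IsBranching G (fun m => m.prod fun i k => F i ^ k) where
  coeff_eq_zero := coeff_prod_pow_eq_zero h
  step m i c := by
    have hadd : ∀ m m' : Fin n →₀ ℕ, ((m + m').prod fun i k => F i ^ k) =
        (m.prod fun i k => F i ^ k) * m'.prod fun i k => F i ^ k :=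
      fun m m' => Finsupp.prod_add_index' (by simp) (fun _ _ _ => pow_add _ _ _)
    have hsub : ∀ q ≤ c, coeff q ((G i).subst F) = ∑ b ∈ Finset.Icc 0 c,
        coeff b (G i) * coeff q (b.prod fun i k => F i ^ k) := fun q hq => by
      rw [coeff_subst (hasSubst_of_constantCoeff_zero h0),
        finsum_eq_sum_of_support_subset (s := Finset.Icc 0 c)]
      · rfl
      · intro b hb
        by_contra hbc
        refine hb ?_
        dsimp only
        rw [coeff_prod_pow_eq_zero h, smul_zero]
        intro hbq
        exact hbc (by simpa using hbq.trans hq)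
    rw [hadd, Finsupp.prod_single_index (by simp), pow_one]
    conv_lhs => rw [h i]
    rw [mul_left_comm, coeff_add_single_X_mul, coeff_mul]
    simp only [hadd, coeff_mul, Finset.mul_sum]
    rw [Finset.sum_comm]
    refine Finset.sum_congr rfl fun p hp => ?_
    rw [Finset.HasAntidiagonal.mem_antidiagonal] at hp
    rw [hsub p.2 (hp ▸ le_add_self), Finset.mul_sum]
    exact Finset.sum_congr rfl fun b _ => by ring

end Branching

/-! ### Gaussian integrals of u^p e^{ūXG(u)} -/

section GaussianIntegral

variable {R : Type*} [CommRing R] {n : ℕ}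

/-- For the identity covariance a bijection contributes 1 if it preserves indices and 0 otherwise.
Such bijections exist only for a = b, and then they form the stabilizer of the index map, of order ∏
(a i)!. -/
theorem gaussianMonomial_one (a b : Fin n → ℕ) :
    gaussianMonomial (1 : Matrix.GeneralLinearGroup (Fin n) R) a b =
      if a = b then ((∏ i, (a i).factorial : ℕ) : R) else 0 := by
  classical
  have hprod : ∀ σ : (Σ i, Fin (a i)) ≃ (Σ i, Fin (b i)),
      ∏ k, (((1 : Matrix.GeneralLinearGroup (Fin n) R)⁻¹ : Matrix.GeneralLinearGroup (Fin n) R) :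
        Matrix (Fin n) (Fin n) R) (σ k).1 k.1 =
      if ∀ k, (σ k).1 = k.1 then 1 else 0 := fun σ => by
    simp only [inv_one, Units.val_one, Matrix.one_apply]
    exact Finset.prod_ite_zero.trans (by simp)
  rw [gaussianMonomial, Finset.sum_congr rfl fun σ _ => hprod σ, map_one, inv_one, Units.val_one,
    one_mul]
  split_ifs with hab
  · subst hab
    rw [Finset.sum_boole]
    congr 1
    have := DomMulAct.stabilizer_card (Sigma.fst : (Σ i, Fin (a i)) → Fin n)
    rw [← Fintype.card_subtype]
    have hc : ∀ i, Fintype.card {x : Σ i, Fin (a i) // x.1 = i} = a i := fun i => by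
      rw [Fintype.card_congr (Equiv.sigmaSubtype i), Fintype.card_fin]
    simp only [hc] at this
    rw [← this]
    exact Fintype.card_congr (Equiv.subtypeEquivRight fun σ => by simp [funext_iff])
  · refine Finset.sum_eq_zero fun σ _ => if_neg fun h => hab (funext fun i => ?_)
    have e : {x : Σ i, Fin (a i) // x.1 = i} ≃ {x : Σ i, Fin (b i) // x.1 = i} :=
      σ.subtypeEquiv fun x => by rw [h]
    simpa using Fintype.card_congr
      (((Equiv.sigmaSubtype i).symm.trans e).trans (Equiv.sigmaSubtype i))

instance finite_var : Finite (Var n) :=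
  Finite.of_surjective
    (Sum.elim Var.uBar (Sum.elim Var.u Var.x) : Fin n ⊕ Fin n ⊕ Fin n → Var n) fun
    | .uBar i => ⟨.inl i, rfl⟩
    | .u i => ⟨.inr (.inl i), rfl⟩
    | .x i => ⟨.inr (.inr i), rfl⟩

/-- The exponent of the monomial `ū^a u^b X^c`. -/
noncomputable def varExp (a b c : Fin n → ℕ) : Var n →₀ ℕ :=
  Finsupp.equivFunOnFinite.symm fun
    | .uBar i => a i
    | .u i => b i
    | .x i => c i

@[simp] theorem varExp_uBar (a b c : Fin n → ℕ) (i : Fin n) : varExp a b c (.uBar i) = a i := rfl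
@[simp] theorem varExp_u (a b c : Fin n → ℕ) (i : Fin n) : varExp a b c (.u i) = b i := rfl
@[simp] theorem varExp_x (a b c : Fin n → ℕ) (i : Fin n) : varExp a b c (.x i) = c i := rfl

theorem var_finsupp_ext {m m' : Var n →₀ ℕ} (h₁ : ∀ i, m (.uBar i) = m' (.uBar i))
    (h₂ : ∀ i, m (.u i) = m' (.u i)) (h₃ : ∀ i, m (.x i) = m' (.x i)) : m = m' :=
  Finsupp.ext fun
    | .uBar i => h₁ i
    | .u i => h₂ i
    | .x i => h₃ i

/-- The part of an exponent relative to the variables `u`. -/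
noncomputable def uPart (m : Var n →₀ ℕ) : Fin n →₀ ℕ :=
  Finsupp.equivFunOnFinite.symm fun i => m (.u i)

@[simp] theorem uPart_apply (m : Var n →₀ ℕ) (i : Fin n) : uPart m i = m (.u i) := rfl

/-- The inclusion of the variables `u` into all variables. -/
def uEmb : Fin n ↪ Var n := ⟨Var.u, fun _ _ h => by injection h⟩

theorem coeff_monomial_mul_rename (a : Fin n → ℕ) (H : MvPowerSeries (Fin n) R)
    (m : Var n →₀ ℕ) [Decidable ((∀ i, m (.uBar i) = a i) ∧ ∀ i, m (.x i) = a i)] :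
    coeff m (monomial (varExp a 0 a) 1 * rename uEmb H) =
      if (∀ i, m (.uBar i) = a i) ∧ ∀ i, m (.x i) = a i then coeff (uPart m) H else 0 := by
  classical
  rw [coeff_monomial_mul, one_mul]
  split_ifs with h₁ h₂ h₂
  · have : m - varExp a 0 a = Finsupp.embDomain uEmb (uPart m) := by
      refine var_finsupp_ext (fun i => ?_) (fun i => ?_) (fun i => ?_)
      · rw [Finsupp.embDomain_of_notMem_range _ _ _ (by simp [uEmb])]
        simp [h₂.1]
      · change _ = Finsupp.embDomain uEmb (uPart m) (uEmb i)
        rw [Finsupp.embDomain_apply_self]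
        simp
      · rw [Finsupp.embDomain_of_notMem_range _ _ _ (by simp [uEmb])]
        simp [h₂.2]
    rw [this, coeff_embDomain_rename]
  · refine coeff_rename_eq_zero _ _ ?_
    rintro ⟨y, hy⟩
    refine h₂ ?_
    have key : ∀ v, (∀ i, uEmb i ≠ v) → m v = varExp a 0 a v := fun v hv => by
      have h0 : (m - varExp a 0 a) v = 0 := by
        rw [← hy, Finsupp.mapDomain_of_notMem_range _ _ (by simpa using hv)]
      have := h₁ v
      rw [Finsupp.tsub_apply] at h0
      omega
    exact ⟨fun i => key _ (by simp [uEmb]), fun i => key _ (by simp [uEmb])⟩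
  · refine absurd ?_ h₁
    intro v
    match v with
    | .uBar i => simp [h₂.1]
    | .u i => simp
    | .x i => simp [h₂.2]
  · rfl

theorem interaction_eq (G : Fin n → MvPowerSeries (Fin n) R) :
    interaction G = ∑ i, X (Var.uBar i) * X (Var.x i) * rename uEmb (G i) := by
  simp only [interaction, rename_eq_subst]
  rfl

theorem constantCoeff_interaction (G : Fin n → MvPowerSeries (Fin n) R) :
    constantCoeff (interaction G) = 0 := by
  simp [interaction]

theorem prod_interaction_pow (G : Fin n → MvPowerSeries (Fin n) R) (a : Fin n → ℕ) :
    ∏ i, (X (Var.uBar i) * X (Var.x i) * rename uEmb (G i)) ^ a i =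
      monomial (varExp a 0 a) 1 * rename uEmb (∏ i, G i ^ a i) := by
  classical
  simp only [mul_pow, Finset.prod_mul_distrib, map_prod, map_pow]
  congr 1
  simp only [X_pow_eq, prod_monomial, monomial_mul_monomial, Finset.prod_const_one, mul_one]
  congr 2
  refine var_finsupp_ext (fun i => ?_) (fun i => ?_) (fun i => ?_) <;>
    simp [Finsupp.single_apply]

/-- Each factor ū_i comes with a factor X_i, so only monomials with equal exponents in ū and X
occur; these exponents select a single term of the multinomial expansion. -/
theorem coeff_interaction_pow (G : Fin n → MvPowerSeries (Fin n) R) (k : ℕ) (m : Var n →₀ ℕ)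
    [Decidable (∀ i, m (.x i) = m (.uBar i))] :
    coeff m (interaction G ^ k) =
      if ∀ i, m (.x i) = m (.uBar i) then
        if k = ∑ i, m (.uBar i) then
          (Nat.multinomial Finset.univ (fun i => m (.uBar i)) : R) *
            coeff (uPart m) (∏ i, G i ^ m (.uBar i))
        else 0
      else 0 := by
  classical
  rw [interaction_eq, Finset.sum_pow_eq_sum_piAntidiag, map_sum]
  have : ∀ a : Fin n → ℕ, coeff m ((Nat.multinomial Finset.univ a : MvPowerSeries (Var n) R) *
      ∏ i, (X (Var.uBar i) * X (Var.x i) * rename uEmb (G i)) ^ a i) =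
      if a = (fun i => m (.uBar i)) then if ∀ i, m (.x i) = m (.uBar i) then
        (Nat.multinomial Finset.univ (fun i => m (.uBar i)) : R) *
            coeff (uPart m) (∏ i, G i ^ m (.uBar i)) else 0 else 0 := fun a => by
    rw [prod_interaction_pow, ← map_natCast (C (σ := Var n) (R := R)), coeff_C_mul,
      coeff_monomial_mul_rename]
    by_cases ha : a = fun i => m (.uBar i)
    · subst ha
      simp
    · rw [if_neg, if_neg ha, mul_zero]
      exact fun h => ha (funext fun i => (h.1 i).symm)
  simp only [this, Finset.sum_ite_eq', Finset.mem_piAntidiag]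
  split_ifs <;> simp_all

variable [Algebra ℚ R]

/-- The factor 1/k! of the exponential, the multinomial coefficient k!/∏ a_i! and the Gaussian
factor ∏ a_i! cancel. -/
theorem factorial_mul_coeff_expInteraction (G : Fin n → MvPowerSeries (Fin n) R)
    (m : Var n →₀ ℕ) [Decidable (∀ i, m (.x i) = m (.uBar i))] :
    coeff m (expInteraction G) * ((∏ i, (m (.uBar i)).factorial : ℕ) : R) =
      if ∀ i, m (.x i) = m (.uBar i) then coeff (uPart m) (∏ i, G i ^ m (.uBar i)) else 0 := by
  rw [expInteraction, PowerSeries.coeff_subst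
    (PowerSeries.HasSubst.of_constantCoeff_zero (constantCoeff_interaction G)),
    finsum_eq_single _ (∑ i, m (.uBar i))]
  · rw [coeff_interaction_pow, if_pos rfl, PowerSeries.coeff_exp]
    split_ifs
    · have h := Nat.multinomial_spec Finset.univ (fun i => m (.uBar i))
      have h' : algebraMap ℚ R (1 / ((∑ i, m (.uBar i)).factorial : ℚ)) *
          (((∑ i, m (.uBar i)).factorial : ℕ) : R) = 1 := by
        rw [← map_natCast (algebraMap ℚ R), ← map_mul, one_div, inv_mul_cancel₀, map_one]
        exact_mod_cast Nat.factorial_ne_zero _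
      rw [← h] at h' ⊢
      push_cast at h' ⊢
      rw [smul_eq_mul]
      linear_combination (coeff (uPart m) (∏ i, G i ^ m (.uBar i))) * h'
    · simp
  · intro k hk
    rw [coeff_interaction_pow, if_neg hk, ite_self, smul_zero]

/-- The target fixes the X exponents as c, the interaction makes the ū exponents equal to them, and
the Gaussian integral makes the u exponents equal to those of ū. A single monomial survives, which
gives both summability and the value [u^c] u^p G(u)^c. -/
theorem coeff_gaussianTerm (G : Fin n → MvPowerSeries (Fin n) R) (p c : Fin n →₀ ℕ)
    (m : Var n →₀ ℕ) [Decidable (m = varExp c c c)] :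
    coeff c (gaussianTerm 1 (monomial (varExp 0 p 0) 1 * expInteraction G) m) =
      if m = varExp c c c then coeff c (monomial p 1 * ∏ i, G i ^ c i) else 0 := by
  classical
  have hp : varExp 0 p 0 ≤ m ↔ p ≤ uPart m := by
    constructor
    · exact fun h i => h (.u i)
    · rintro h (i | i | i)
      · simp
      · exact h i
      · simp
  have hu : uPart (m - varExp 0 p 0) = uPart m - p := by ext i; simp
  rw [gaussianTerm, gaussianMonomial_one, coeff_monomial, coeff_monomial_mul, coeff_monomial_mul,
    one_mul, one_mul]
  have key := factorial_mul_coeff_expInteraction G (m - varExp 0 p 0)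
  simp only [Finsupp.tsub_apply, varExp_uBar, varExp_x, Pi.zero_apply, tsub_zero, hu] at key
  by_cases hm : m = varExp c c c
  · have hm' : uPart m = c := by ext i; simp [hm]
    rw [if_pos hm, if_pos (by ext i; simp [hm])]
    simp only [hp, hm'] at *
    split_ifs with h₁ h₂
    · rw [key, if_pos (by simp [hm])]
      simp [hm]
    · exact absurd (by simp [hm]) h₂
    · simp
    · simp
  · rw [if_neg hm]
    split_ifs with h₁ h₂ h₃
    · rw [key, if_neg]
      refine fun hx => hm (var_finsupp_ext (fun i => ?_) (fun i => ?_) (fun i => ?_))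
      · rw [← hx, h₁]; rfl
      · rw [← congr_fun h₃ i, ← hx, h₁]; rfl
      · rw [h₁]; rfl
    all_goals simp

theorem gaussianSummable_monomial_mul (G : Fin n → MvPowerSeries (Fin n) R) (p : Fin n →₀ ℕ) :
    GaussianSummable 1 (monomial (varExp 0 p 0) 1 * expInteraction G) := by
  classical
  intro c
  refine (Set.finite_singleton (varExp c c c)).subset fun m hm => ?_
  by_contra h
  exact hm (by rw [coeff_gaussianTerm, if_neg (by simpa using h)])

theorem coeff_gaussianIntegral (G : Fin n → MvPowerSeries (Fin n) R) (p c : Fin n →₀ ℕ) :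
    coeff c (gaussianIntegral 1 (monomial (varExp 0 p 0) 1 * expInteraction G)) =
      coeff c (monomial p 1 * ∏ i, G i ^ c i) := by
  classical
  change ∑ᶠ m, coeff c (gaussianTerm 1 (monomial (varExp 0 p 0) 1 * expInteraction G) m) = _
  rw [finsum_eq_single _ (varExp c c c), coeff_gaussianTerm, if_pos rfl]
  intro m hm
  rw [coeff_gaussianTerm, if_neg hm]

/-- Integration by parts. -/
theorem isBranching_gaussianIntegral (G : Fin n → MvPowerSeries (Fin n) R) :
    IsBranching G
      fun p => gaussianIntegral 1 (monomial (varExp 0 p 0) 1 * expInteraction G) where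
  coeff_eq_zero p c h := by
    rw [coeff_gaussianIntegral, coeff_monomial_mul, if_neg h]
  step m i c := by
    classical
    simp only [coeff_gaussianIntegral]
    have h₁ : ∏ j, G j ^ (c + Finsupp.single i 1 : Fin n →₀ ℕ) j = (∏ j, G j ^ c j) * G i := by
      simp only [Finsupp.add_apply, pow_add, Finset.prod_mul_distrib, Finsupp.single_apply]
      rw [Finset.prod_pow_boole, if_pos (Finset.mem_univ i)]
    have h₂ : (monomial (m + Finsupp.single i 1) 1 : MvPowerSeries (Fin n) R) =
        X i * monomial m 1 := by
      rw [X, monomial_mul_monomial, add_comm, one_mul]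
    have h₃ : ∀ b, (monomial (m + b) 1 : MvPowerSeries (Fin n) R) =
        monomial b 1 * monomial m 1 := fun b => by
      rw [monomial_mul_monomial, add_comm, one_mul]
    -- After cancelling u_i the left side is [u^c] G_i · (G^c u^m); expanding the factor G_i in
    -- monomials u^b gives the recursion.
    rw [h₁, h₂, mul_assoc, coeff_add_single_X_mul, ← mul_assoc, mul_comm _ (G i), coeff_mul]
    simp only [h₃, mul_assoc]
    refine Finset.sum_nbij' Prod.fst (fun b => (b, c - b)) (fun p hp => ?_) (fun b hb => ?_)
      (fun p hp => ?_) (fun b _ => rfl) (fun p hp => ?_)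
    · rw [Finset.HasAntidiagonal.mem_antidiagonal] at hp
      simp [← hp]
    · rw [Finset.HasAntidiagonal.mem_antidiagonal]
      exact add_tsub_cancel_of_le (Finset.mem_Icc.1 hb).2
    · rw [Finset.HasAntidiagonal.mem_antidiagonal] at hp
      simp [← hp]
    · rw [Finset.HasAntidiagonal.mem_antidiagonal] at hp
      rw [← hp, coeff_add_monomial_mul, one_mul]

end GaussianIntegral

/-! ### Enumeration of labelled forests by deletion of a root -/

section Forests

set_option linter.unusedSectionVars false

variable {R : Type*} [CommRing R] {n : ℕ} {V W T : Type*} [Fintype V] [DecidableEq V] [Fintype W]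
  [DecidableEq W] [DecidableEq T]

/-- The multiplicities of the indices `β v` of the elements `v` with `f v = t`. -/
noncomputable def fiberType (f : V → T) (β : V → Fin n) (t : T) : Fin n →₀ ℕ :=
  ∑ v with f v = t, Finsupp.single (β v) 1

/-- The multiplicities of the family of indices `β`. -/
noncomputable def totalType (β : V → Fin n) : Fin n →₀ ℕ := ∑ v, Finsupp.single (β v) 1

/-- A map sending each vertex to its parent, or to `none` for a root, is a forest if every vertex
descends from a root. -/
def IsForest (f : V → Option V) : Prop := WellFounded fun w v => f v = some w

/-- The symmetric tensor coefficient `b! [X^b] G_i`. -/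
noncomputable def tensorCoeff (G : Fin n → MvPowerSeries (Fin n) R) (i : Fin n)
    (b : Fin n →₀ ℕ) : R :=
  ((∏ j, (b j).factorial : ℕ) : R) * coeff b (G i)

/-- The weight of a forest with vertices indexed by `β`. -/
noncomputable def forestWeight (G : Fin n → MvPowerSeries (Fin n) R) (f : V → Option V)
    (β : V → Fin n) : R :=
  ∏ v, tensorCoeff G (β v) (fiberType f β (some v))

open Classical in
/-- The weight of a forest with vertices indexed by `β`, if the multiplicities are `c` for its
vertices and `m` for its roots. -/
noncomputable def forestTerm (G : Fin n → MvPowerSeries (Fin n) R) (c m : Fin n →₀ ℕ)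
    (f : V → Option V) (β : V → Fin n) : R :=
  if IsForest f ∧ totalType β = c ∧ fiberType f β none = m then forestWeight G f β else 0

variable (V) in
/-- The total weight of the forests on `V`, with multiplicities of indices `c` for the vertices
and `m` for the roots. -/
noncomputable def forestSum (G : Fin n → MvPowerSeries (Fin n) R) (c m : Fin n →₀ ℕ) : R :=
  ∑ f : V → Option V, ∑ β : V → Fin n, forestTerm G c m f β

/-- The part of `forestSum` where `r` is a root of index `i`. -/
noncomputable def rootedForestSum (G : Fin n → MvPowerSeries (Fin n) R) (c m : Fin n →₀ ℕ)
    (r : V) (i : Fin n) : R :=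
  ∑ f : V → Option V, if f r = none then
    ∑ β : V → Fin n, if β r = i then forestTerm G c m f β else 0 else 0

theorem fiberType_apply (f : V → T) (β : V → Fin n) (t : T) (i : Fin n) :
    fiberType f β t i = (Finset.univ.filter fun v => f v = t ∧ β v = i).card := by
  rw [fiberType, Finsupp.finsetSum_apply, Finset.sum_filter, Finset.card_filter]
  refine Finset.sum_congr rfl fun v _ => ?_
  by_cases h : f v = t <;> simp [h, Finsupp.single_apply]

theorem fiberType_le_totalType (f : V → T) (β : V → Fin n) (t : T) :
    fiberType f β t ≤ totalType β :=
  Finset.sum_le_sum_of_subset (Finset.filter_subset _ _)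

/-- Transport of a parent map along a bijection. -/
def conjMap (e : V ≃ W) (f : V → Option V) : W → Option W := fun w => (f (e.symm w)).map e

/-- Transport of parent maps along a bijection, as a bijection. -/
def conjEquiv (e : V ≃ W) : (V → Option V) ≃ (W → Option W) where
  toFun := conjMap e
  invFun := conjMap e.symm
  left_inv f := by ext1 v; simp [conjMap]
  right_inv f := by ext1 v; simp [conjMap]

theorem fiberType_conjMap (e : V ≃ W) (f : V → Option V) (β : V → Fin n) (o : Option V) :
    fiberType (conjMap e f) (β ∘ e.symm) (o.map e) = fiberType f β o := by
  refine Finset.sum_equiv e.symm (fun w => ?_) (fun w _ => rfl)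
  simp [conjMap, (Option.map_injective e.injective).eq_iff]

theorem isForest_conjMap (e : V ≃ W) {f : V → Option V} (hf : IsForest f) :
    IsForest (conjMap e f) := by
  refine Subrelation.wf ?_ (InvImage.wf e.symm hf)
  intro w w' h
  obtain ⟨v, hv, rfl⟩ := Option.map_eq_some_iff.1 h
  simpa [InvImage] using hv

theorem isForest_conjMap_iff (e : V ≃ W) (f : V → Option V) :
    IsForest (conjMap e f) ↔ IsForest f :=
  ⟨fun h => by simpa using (conjEquiv e).left_inv f ▸ isForest_conjMap e.symm h,
    isForest_conjMap e⟩

theorem forestTerm_conjMap (e : V ≃ W) (G : Fin n → MvPowerSeries (Fin n) R) (c m : Fin n →₀ ℕ)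
    (f : V → Option V) (β : V → Fin n) :
    forestTerm G c m (conjMap e f) (β ∘ e.symm) = forestTerm G c m f β := by
  have h₁ : totalType (β ∘ e.symm) = totalType β :=
    Fintype.sum_equiv e.symm _ _ fun _ => rfl
  have h₂ : forestWeight G (conjMap e f) (β ∘ e.symm) = forestWeight G f β := by
    refine (Fintype.prod_equiv e _ _ fun v => ?_).symm
    rw [← fiberType_conjMap e f β (some v)]
    simp
  have h₃ := fiberType_conjMap e f β none
  rw [Option.map_none] at h₃
  classical
  rw [forestTerm, forestTerm, h₂]
  exact if_congr (by rw [h₁, h₃, isForest_conjMap_iff]) rfl rfl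

/-- Invariance under relabelling: a marked root can be moved to the point `none` of an `Option`
type, where deleting it is easy. -/
theorem rootedForestSum_congr (e : V ≃ W) (G : Fin n → MvPowerSeries (Fin n) R)
    (c m : Fin n →₀ ℕ) (r : V) (i : Fin n) :
    rootedForestSum G c m r i = rootedForestSum G c m (e r) i := by
  refine Fintype.sum_equiv (conjEquiv e) _ _ fun f => ?_
  have : (conjEquiv e f) (e r) = none ↔ f r = none := by simp [conjEquiv, conjMap]
  simp only [this]
  congr 1
  refine Fintype.sum_equiv (e.arrowCongr (Equiv.refl _)) _ _ fun β => ?_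
  rw [← forestTerm_conjMap e]
  exact if_congr (by simp) rfl rfl

/-- Double counting of pairs (forest, marked root of index i): each contributing forest has m i such
roots. -/
theorem mul_forestSum_eq_sum_rootedForestSum (G : Fin n → MvPowerSeries (Fin n) R)
    (c m : Fin n →₀ ℕ) (i : Fin n) :
    (m i : R) * forestSum V G c m = ∑ r : V, rootedForestSum G c m r i := by
  simp only [forestSum, rootedForestSum, Finset.mul_sum]
  conv_rhs => rw [Finset.sum_comm]
  refine Finset.sum_congr rfl fun f _ => ?_
  have : ∀ r : V, (if f r = none then (∑ β : V → Fin n,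
      if β r = i then forestTerm G c m f β else 0 : R) else 0) =
      (∑ β : V → Fin n, if f r = none ∧ β r = i then forestTerm G c m f β else 0 : R) := fun r => by
    by_cases h : f r = none <;> simp [h]
  rw [Finset.sum_congr rfl fun r _ => this r, Finset.sum_comm]
  refine Finset.sum_congr rfl fun β _ => ?_
  rw [← Finset.sum_filter, Finset.sum_const, nsmul_eq_mul, ← fiberType_apply]
  by_cases h : fiberType f β none = m
  · rw [h]
  · simp [forestTerm, h]

theorem sum_option_fun [Fintype T] {M : Type*} [AddCommMonoid M] (F : (Option W → T) → M) (x : T) :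
    (∑ h : Option W → T, if h none = x then F h else 0) =
      ∑ g : W → T, F fun o => o.elim x g := by
  rw [← Finset.sum_filter]
  refine Finset.sum_nbij' (fun h w => h (some w)) (fun g o => o.elim x g) (by simp) (by simp)
    (fun h hh => ?_) (fun g _ => rfl) (fun h hh => ?_)
  all_goals
    have : (fun o : Option W => o.elim x fun w => h (some w)) = h := by
      funext o
      cases o with
      | none => simpa using (Finset.mem_filter.1 hh).2.symm
      | some w => rfl
    simp [this]

/-- The forest map on `W` together with a new root, with the elements of `A` as children. -/
def graft (f : W → Option W) (A : Finset W) : W → Option (Option W) :=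
  fun w => if w ∈ A then some none else (f w).map some

/-- Deleting the root `none` makes its children roots. Conversely, parent maps above a new root
amount to a parent map on `W` and a set `A` of its roots chosen as children; `Option.join` forgets
the new root. -/
theorem sum_eq_sum_graft {M : Type*} [AddCommMonoid M] (H : (W → Option (Option W)) → M) :
    ∑ g, H g = ∑ f : W → Option W,
      ∑ A ∈ (Finset.univ.filter fun w => f w = none).powerset, H (graft f A) := by
  have hg : ∀ g : W → Option (Option W),
      graft (fun w => (g w).join) (Finset.univ.filter fun w => g w = some none) = g := by
    intro g
    funext w
    rcases h : g w with _ | _ | w' <;> simp [graft, h]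
  rw [Finset.sum_sigma']
  refine Finset.sum_nbij'
    (fun g => ⟨fun w => (g w).join, Finset.univ.filter fun w => g w = some none⟩)
    (fun p => graft p.1 p.2) (fun g _ => ?_) (by simp) (fun g _ => hg g) (fun p hp => ?_)
    (fun g _ => by simp only [hg])
  · simp only [Finset.mem_sigma, Finset.mem_univ, true_and, Finset.mem_powerset]
    intro w hw
    simp only [Finset.mem_filter, Finset.mem_univ, true_and] at hw ⊢
    simp [hw]
  · obtain ⟨f, A⟩ := p
    simp only [Finset.mem_sigma, Finset.mem_univ, true_and, Finset.mem_powerset] at hp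
    have h₁ : (fun w => (graft f A w).join) = f := by
      funext w
      by_cases hw : w ∈ A
      · have := hp hw
        simp only [Finset.mem_filter, Finset.mem_univ, true_and] at this
        simp [graft, hw, this]
      · cases h : f w <;> simp [graft, hw, h]
    have h₂ : (Finset.univ.filter fun w => graft f A w = some none) = A := by
      ext w
      by_cases hw : w ∈ A <;> simp [graft, hw]
    simp only [h₁, h₂]

/-- Grafting only adds links to the new root, which has no parent and so is accessible. -/
theorem isForest_elim_graft_iff {f : W → Option W} {A : Finset W}
    (hA : ∀ w ∈ A, f w = none) :
    IsForest (fun o : Option W => o.elim none (graft f A)) ↔ IsForest f := by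
  constructor
  · intro h
    refine Subrelation.wf ?_ (InvImage.wf some h)
    intro w v hv
    have : v ∉ A := fun hvA => by simp [hA v hvA] at hv
    simp [InvImage, graft, this, hv]
  · intro h
    have hnone : Acc (fun (w v : Option W) => v.elim none (graft f A) = some w) none :=
      ⟨_, fun y hy => by simp at hy⟩
    refine ⟨fun o => ?_⟩
    cases o with
    | none => exact hnone
    | some v =>
      induction v using h.induction with
      | _ v ih =>
        refine ⟨_, fun y hy => ?_⟩
        cases y with
        | none => exact hnone
        | some w =>
          refine ih w ?_
          by_cases hv : v ∈ A
          · simp [graft, hv] at hy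
          · simpa [graft, hv] using hy

theorem totalType_elim (i : Fin n) (β : W → Fin n) :
    totalType (fun o : Option W => o.elim i β) = totalType β + Finsupp.single i 1 := by
  simp [totalType, Fintype.sum_option, add_comm]

theorem fiberType_elim (x : T) (g : W → T) (i : Fin n) (β : W → Fin n) (t : T) :
    fiberType (fun o : Option W => o.elim x g) (fun o => o.elim i β) t =
      fiberType g β t + if x = t then Finsupp.single i 1 else 0 := by
  rw [fiberType, fiberType, Finset.sum_filter, Fintype.sum_option, Finset.sum_filter, add_comm]
  rfl

theorem fiberType_graft_some_none (f : W → Option W) (A : Finset W) (β : W → Fin n) :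
    fiberType (graft f A) β (some none) = ∑ w ∈ A, Finsupp.single (β w) 1 := by
  refine Finset.sum_congr ?_ fun _ _ => rfl
  ext w
  by_cases hw : w ∈ A <;> simp [graft, hw]

theorem fiberType_graft_some_some {f : W → Option W} {A : Finset W}
    (hA : ∀ w ∈ A, f w = none) (β : W → Fin n) (v : W) :
    fiberType (graft f A) β (some (some v)) = fiberType f β (some v) := by
  refine Finset.sum_congr ?_ fun _ _ => rfl
  ext w
  rw [Finset.mem_filter, Finset.mem_filter]
  by_cases hw : w ∈ A
  · simp [graft, hw, hA w hw]
  · simp [graft, hw]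

theorem fiberType_graft_none {f : W → Option W} {A : Finset W}
    (hA : ∀ w ∈ A, f w = none) (β : W → Fin n) :
    fiberType (graft f A) β none + ∑ w ∈ A, Finsupp.single (β w) 1 = fiberType f β none := by
  have : (Finset.univ.filter fun w => graft f A w = none) =
      (Finset.univ.filter fun w => f w = none) \ A := by
    ext w
    rw [Finset.mem_sdiff, Finset.mem_filter, Finset.mem_filter]
    by_cases hw : w ∈ A <;> simp [graft, hw]
  rw [fiberType, this, Finset.sum_sdiff]
  · rfl
  · intro w hw
    simpa using hA w hw

/-- The new root contributes the tensor coefficient of its children's indices, the other vertices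
keep their children, and after deletion these children join the remaining roots. -/
theorem forestTerm_elim_graft {f : W → Option W} {A : Finset W} (hA : ∀ w ∈ A, f w = none)
    (G : Fin n → MvPowerSeries (Fin n) R) (c m : Fin n →₀ ℕ) (i : Fin n) (β : W → Fin n) :
    forestTerm G (c + Finsupp.single i 1) (m + Finsupp.single i 1)
        (fun o : Option W => o.elim none (graft f A)) (fun o => o.elim i β) =
      tensorCoeff G i (∑ w ∈ A, Finsupp.single (β w) 1) *
        forestTerm G c (m + ∑ w ∈ A, Finsupp.single (β w) 1) f β := by
  have hw : forestWeight G (fun o : Option W => o.elim none (graft f A)) (fun o => o.elim i β) =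
      tensorCoeff G i (∑ w ∈ A, Finsupp.single (β w) 1) * forestWeight G f β := by
    simp only [forestWeight, Fintype.prod_option, fiberType_elim, Option.elim_none,
      Option.elim_some, fiberType_graft_some_none, fiberType_graft_some_some hA]
    simp
  have hn : fiberType (graft f A) β none = m ↔
      fiberType f β none = m + ∑ w ∈ A, Finsupp.single (β w) 1 := by
    rw [← fiberType_graft_none hA, add_left_inj]
  classical
  rw [forestTerm, forestTerm, hw, mul_ite, mul_zero]
  refine if_congr ?_ rfl rfl
  rw [isForest_elim_graft_iff hA, totalType_elim, fiberType_elim, if_pos rfl, add_left_inj,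
    add_left_inj, hn]

/-- The elements of each index are chosen independently. -/
theorem card_powerset_filter_type (S : Finset W) (β : W → Fin n) (b : Fin n →₀ ℕ) :
    (S.powerset.filter fun A => ∑ w ∈ A, Finsupp.single (β w) 1 = b).card =
      ∏ j, ((∑ w ∈ S, Finsupp.single (β w) 1 : Fin n →₀ ℕ) j).choose (b j) := by
  have happ : ∀ (A : Finset W) (j : Fin n),
      (∑ w ∈ A, Finsupp.single (β w) 1 : Fin n →₀ ℕ) j = (A.filter fun w => β w = j).card := by
    intro A j
    simp [Finsupp.finsetSum_apply, Finsupp.single_apply]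
  have h : ∀ j, ((∑ w ∈ S, Finsupp.single (β w) 1 : Fin n →₀ ℕ) j).choose (b j) =
      ((S.filter fun w => β w = j).powersetCard (b j)).card := fun j => by
    rw [Finset.card_powersetCard, happ]
  simp only [h]
  rw [← Fintype.card_piFinset]
  refine Finset.card_nbij' (fun A j => A.filter fun w => β w = j)
    (fun q => S.filter fun w => w ∈ q (β w)) (fun A hA => ?_) (fun q hq => ?_) (fun A hA => ?_)
    (fun q hq => ?_)
  · simp only [Finset.coe_filter, Finset.mem_powerset, Set.mem_ofPred_eq] at hA
    simp only [Finset.mem_coe, Fintype.mem_piFinset, Finset.mem_powersetCard]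
    exact fun j => ⟨Finset.filter_subset_filter _ hA.1, by rw [← hA.2, happ]⟩
  · simp only [Finset.mem_coe, Fintype.mem_piFinset, Finset.mem_powersetCard] at hq
    simp only [Finset.coe_filter, Finset.mem_powerset, Set.mem_ofPred_eq]
    refine ⟨Finset.filter_subset _ _, ?_⟩
    ext j
    rw [happ, ← (hq j).2]
    congr 1
    ext w
    simp only [Finset.mem_filter]
    constructor
    · rintro ⟨⟨_, h⟩, rfl⟩
      exact h
    · intro h
      obtain ⟨hS, rfl⟩ := Finset.mem_filter.1 ((hq j).1 h)
      exact ⟨⟨hS, h⟩, rfl⟩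
  · simp only [Finset.coe_filter, Finset.mem_powerset, Set.mem_ofPred_eq] at hA
    ext w
    simp only [Finset.mem_filter, and_true]
    exact ⟨fun h => h.2, fun h => ⟨hA.1 h, h⟩⟩
  · simp only [Finset.mem_coe, Fintype.mem_piFinset, Finset.mem_powersetCard] at hq
    funext j
    ext w
    simp only [Finset.mem_filter]
    constructor
    · rintro ⟨⟨_, h⟩, rfl⟩
      exact h
    · intro h
      obtain ⟨hS, rfl⟩ := Finset.mem_filter.1 ((hq j).1 h)
      exact ⟨⟨hS, h⟩, rfl⟩

/-- Group the sets of children by their type b. They are chosen among the roots of a forest with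
root type m + b, whence the binomial coefficients; b ≤ c because the children are among the
vertices. -/
theorem rootedForestSum_none (G : Fin n → MvPowerSeries (Fin n) R) (c m : Fin n →₀ ℕ)
    (i : Fin n) :
    rootedForestSum (V := Option W) G (c + Finsupp.single i 1) (m + Finsupp.single i 1) none i =
      ∑ b ∈ Finset.Icc 0 c, ((∏ j, (m j + b j).choose (b j) : ℕ) : R) * tensorCoeff G i b *
        forestSum W G c (m + b) := by
  rw [rootedForestSum, sum_option_fun (fun f : Option W → Option (Option W) =>
    ∑ β : Option W → Fin n, if β none = i then
      forestTerm G (c + Finsupp.single i 1) (m + Finsupp.single i 1) f β else 0) none,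
    sum_eq_sum_graft]
  simp only [sum_option_fun]
  simp only [forestSum, Finset.mul_sum]
  rw [Finset.sum_comm]
  refine Finset.sum_congr rfl fun f _ => ?_
  rw [Finset.sum_comm, Finset.sum_comm (s := Finset.Icc 0 c)]
  refine Finset.sum_congr rfl fun β _ => ?_
  have hterm : ∀ A ∈ (Finset.univ.filter fun w => f w = none).powerset,
      forestTerm G (c + Finsupp.single i 1) (m + Finsupp.single i 1)
        (fun o : Option W => o.elim none (graft f A)) (fun o => o.elim i β) =
      ∑ b ∈ Finset.Icc 0 c, if ∑ w ∈ A, Finsupp.single (β w) 1 = b then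
        tensorCoeff G i b * forestTerm G c (m + b) f β else 0 := fun A hA => by
    rw [forestTerm_elim_graft (fun w hw => by simpa using Finset.mem_powerset.1 hA hw),
      Finset.sum_ite_eq]
    split_ifs with h
    · rfl
    · have : totalType β ≠ c := by
        rintro rfl
        refine h ?_
        simp only [Finset.mem_Icc, zero_le, true_and]
        exact Finset.sum_le_sum_of_subset (Finset.subset_univ _)
      simp [forestTerm, this]
  rw [Finset.sum_congr rfl hterm, Finset.sum_comm]
  refine Finset.sum_congr rfl fun b _ => ?_
  rw [← Finset.sum_filter, Finset.sum_const, card_powerset_filter_type, nsmul_eq_mul, mul_assoc]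
  by_cases h : fiberType f β none = m + b
  · rw [fiberType] at h
    rw [h]
    rfl
  · simp [forestTerm, h]

theorem forestSum_zero_of_isEmpty [IsEmpty V] (G : Fin n → MvPowerSeries (Fin n) R) :
    forestSum V G 0 0 = 1 := by
  rw [forestSum, Fintype.sum_unique, Fintype.sum_unique, forestTerm, if_pos]
  · simp [forestWeight]
  · exact ⟨⟨fun v => isEmptyElim v⟩, by simp [totalType], by simp [fiberType]⟩

/-- A minimal vertex for the parent relation is a root, so a nonempty forest has nonzero root type.
-/
theorem forestSum_zero_of_nonempty [Nonempty V] (G : Fin n → MvPowerSeries (Fin n) R)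
    (c : Fin n →₀ ℕ) : forestSum V G c 0 = 0 := by
  refine Finset.sum_eq_zero fun f _ => Finset.sum_eq_zero fun β _ => if_neg ?_
  rintro ⟨hf, -, h⟩
  obtain ⟨v, -, hv⟩ := hf.has_min Set.univ Set.univ_nonempty
  have hv' : f v = none := by
    by_contra hne
    obtain ⟨w, hw⟩ := Option.ne_none_iff_exists'.1 hne
    exact hv w (Set.mem_univ _) hw
  have := fiberType_apply f β none (β v)
  rw [h, Finsupp.zero_apply, eq_comm, Finset.card_eq_zero, Finset.filter_eq_empty_iff] at this
  exact this (Finset.mem_univ v) ⟨hv', rfl⟩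

variable [Algebra ℚ R]

/-- The exponential generating series of the forests with root multiplicities `m`, times `m!`. -/
noncomputable def forestSeries (G : Fin n → MvPowerSeries (Fin n) R) (m : Fin n →₀ ℕ) :
    MvPowerSeries (Fin n) R :=
  fun c => algebraMap ℚ R ((∏ j, (m j).factorial : ℕ) / (c.degree.factorial : ℚ)) *
    forestSum (Fin c.degree) G c m

theorem coeff_forestSeries (G : Fin n → MvPowerSeries (Fin n) R) (m c : Fin n →₀ ℕ) :
    coeff c (forestSeries G m) =
      algebraMap ℚ R ((∏ j, (m j).factorial : ℕ) / (c.degree.factorial : ℚ)) *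
        forestSum (Fin c.degree) G c m := rfl

/-- Marking a root gives (m_i + 1) on one side and the |c| + 1 possible positions of that root on
the other. The factorials are absorbed by (m + e_i)! = (m_i + 1) m! and m! b! ∏ C(m_j + b_j, b_j) =
(m + b)!; here b! comes from the tensor element. -/
theorem isBranching_forestSeries (G : Fin n → MvPowerSeries (Fin n) R) :
    IsBranching G (forestSeries G) where
  coeff_eq_zero m c h := by
    rw [coeff_forestSeries, forestSum, Finset.sum_eq_zero, mul_zero]
    refine fun f _ => Finset.sum_eq_zero fun β _ => if_neg ?_
    rintro ⟨_, h₁, h₂⟩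
    exact h (h₁ ▸ h₂ ▸ fiberType_le_totalType f β none)
  step m i c := by
    have hdeg : (c + Finsupp.single i 1).degree = c.degree + 1 := by simp
    have hroot := mul_forestSum_eq_sum_rootedForestSum (V := Fin (c.degree + 1)) G
      (c + Finsupp.single i 1) (m + Finsupp.single i 1) i
    have hr : ∀ r : Fin (c.degree + 1), rootedForestSum G (c + Finsupp.single i 1)
        (m + Finsupp.single i 1) r i = rootedForestSum (V := Option (Fin c.degree)) G
        (c + Finsupp.single i 1) (m + Finsupp.single i 1) none i := fun r => by
      rw [rootedForestSum_congr (finSuccEquiv' r), finSuccEquiv'_at]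
    simp only [hr, rootedForestSum_none, Finset.sum_const, Finset.card_univ, Fintype.card_fin,
      nsmul_eq_mul] at hroot
    have hfac : ∏ j, ((m + Finsupp.single i 1 : Fin n →₀ ℕ) j).factorial =
        (∏ j, (m j).factorial) * (m i + 1) := by
      have : ∀ j, ((m + Finsupp.single i 1 : Fin n →₀ ℕ) j).factorial =
          (m j).factorial * if i = j then m j + 1 else 1 := fun j => by
        by_cases hj : i = j
        · subst hj
          simp [Nat.factorial_succ, mul_comm]
        · simp [hj]
      simp only [this, Finset.prod_mul_distrib, Finset.prod_ite_eq, Finset.mem_univ, if_true]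
    rw [coeff_forestSeries, hdeg, hfac]
    have hc : (algebraMap ℚ R (((∏ j, (m j).factorial) * (m i + 1) : ℕ) /
        ((c.degree + 1).factorial : ℚ))) = algebraMap ℚ R ((∏ j, (m j).factorial : ℕ) /
        ((c.degree + 1).factorial : ℚ)) *
          (((m + Finsupp.single i 1 : Fin n →₀ ℕ) i : ℕ) : R) := by
      rw [← map_natCast (algebraMap ℚ R), ← map_mul]
      congr 1
      simp
      ring
    rw [hc, mul_assoc, hroot, ← mul_assoc]
    have hc' : algebraMap ℚ R ((∏ j, (m j).factorial : ℕ) /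
        ((c.degree + 1).factorial : ℚ)) * ((c.degree + 1 : ℕ) : R) =
        algebraMap ℚ R ((∏ j, (m j).factorial : ℕ) / (c.degree.factorial : ℚ)) := by
      rw [← map_natCast (algebraMap ℚ R), ← map_mul]
      congr 1
      rw [Nat.factorial_succ]
      have : (c.degree.factorial : ℚ) ≠ 0 := by exact_mod_cast Nat.factorial_ne_zero _
      push_cast
      field_simp
    rw [hc', Finset.mul_sum]
    refine Finset.sum_congr rfl fun b _ => ?_
    have hb : (∏ j, ((m + b) j).factorial) = (∏ j, (m j).factorial) *
        ((∏ j, (m j + b j).choose (b j)) * ∏ j, (b j).factorial) := by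
      simp only [← Finset.prod_mul_distrib]
      refine Finset.prod_congr rfl fun j _ => ?_
      rw [Finsupp.add_apply, ← Nat.add_choose_mul_factorial_mul_factorial]
      ring
    rw [coeff_forestSeries, hb, tensorCoeff]
    have hd : algebraMap ℚ R (((∏ j, (m j).factorial) *
        ((∏ j, (m j + b j).choose (b j)) * ∏ j, (b j).factorial) : ℕ) /
        (c.degree.factorial : ℚ)) =
        algebraMap ℚ R ((∏ j, (m j).factorial : ℕ) / (c.degree.factorial : ℚ)) *
        (((∏ j, (m j + b j).choose (b j) : ℕ) : R) * ((∏ j, (b j).factorial : ℕ) : R)) := by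
      rw [← map_natCast (algebraMap ℚ R), ← map_natCast (algebraMap ℚ R), ← map_mul, ← map_mul]
      congr 1
      push_cast
      ring
    rw [hd]
    ring

theorem forestSeries_zero (G : Fin n → MvPowerSeries (Fin n) R) : forestSeries G 0 = 1 := by
  classical
  ext c
  rw [coeff_forestSeries, coeff_one]
  split_ifs with hc
  · subst hc
    have : IsEmpty (Fin (Finsupp.degree (0 : Fin n →₀ ℕ))) := by
      rw [map_zero]
      infer_instance
    rw [forestSum_zero_of_isEmpty]
    simp
  · have : Nonempty (Fin c.degree) :=
      ⟨⟨0, Nat.pos_of_ne_zero fun h => hc (Finsupp.degree_eq_zero_iff c |>.1 h)⟩⟩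
    rw [forestSum_zero_of_nonempty, mul_zero]

end Forests

/-! ### The diagram of a parent map -/

section TreeDiagrams

set_option linter.unusedSectionVars false

variable {V W : Type*} {E E' : Type*} [Fintype V] [DecidableEq V] [Fintype W]
  [DecidableEq W] [Fintype E] [DecidableEq E] [Fintype E'] [DecidableEq E']

/-- Allows equality of diagrams to be checked datum by datum, although the type of the contraction
depends on other fields. -/
theorem FeynmanDiagram.eq_of_isIso_refl {I J : Type*} {D D' : FeynmanDiagram I J E}
    (h : FeynmanDiagram.IsIso (Equiv.refl E) D D') : D = D' := by
  obtain ⟨h₁, h₂, h₃, h₄, h₅, h₆, h₇, h₈⟩ := h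
  obtain ⟨⟨a₁, a₂, a₃, a₄, a₅, a₆, a₇, _, _, _, _, _, _, _, _, _, _⟩, a₈⟩ := D
  obtain ⟨⟨b₁, b₂, b₃, b₄, b₅, b₆, b₇, _, _, _, _, _, _, _, _, _, _⟩, b₈⟩ := D'
  have hv : Finset.mapEmbedding (Equiv.refl E).toEmbedding = RelEmbedding.refl _ := by
    ext s x; simp
  have h₆' : a₆ = b₆ := funext h₆
  have h₇' : a₇ = b₇ := funext h₇
  rw [hv] at h₅
  have h₁' : a₁ = b₁ := Finset.map_refl.symm.trans h₁
  have h₂' : a₂ = b₂ := Finset.map_refl.symm.trans h₂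
  have h₃' : a₃ = b₃ := Finset.map_refl.symm.trans h₃
  have h₄' : a₄ = b₄ := Finset.map_refl.symm.trans h₄
  have h₅' : a₅ = b₅ := Finset.map_refl.symm.trans h₅
  subst h₁' h₂' h₃' h₄' h₅' h₆' h₇'
  congr 1
  ext ⟨x, hx⟩
  exact h₈ x hx hx

/-- The vertex to which a half-line belongs (`none` for the root), in the diagram of a parent
map `f`: the half-lines are the `ū` half-lines `e (inl v)` of the vertices `v` and the
`u` half-lines `e (inr v)` with which they are contracted. -/
def cellOf (e : V ⊕ V ≃ E) (f : V → Option V) (x : E) : Option V :=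
  Sum.elim some f (e.symm x)

@[simp] theorem cellOf_inl (e : V ⊕ V ≃ E) (f : V → Option V) (v : V) :
    cellOf e f (e (.inl v)) = some v := by simp [cellOf]

@[simp] theorem cellOf_inr (e : V ⊕ V ≃ E) (f : V → Option V) (v : V) :
    cellOf e f (e (.inr v)) = f v := by simp [cellOf]

/-- The half-lines belonging to a given vertex, or to the root. -/
def cellFinset (e : V ⊕ V ≃ E) (f : V → Option V) (o : Option V) : Finset E :=
  Finset.univ.filter fun x => cellOf e f x = o

@[simp] theorem mem_cellFinset {e : V ⊕ V ≃ E} {f : V → Option V} {o : Option V} {x : E} :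
    x ∈ cellFinset e f o ↔ cellOf e f x = o := by simp [cellFinset]

/-- The contraction scheme of the diagram of a parent map. -/
noncomputable def treeContraction (e : V ⊕ V ≃ E) :
    {x // x ∈ Finset.univ.image fun v => e (.inl v)} ≃
      {x // x ∈ Finset.univ.image fun v => e (.inr v)} :=
  (Equiv.ofBijective (fun v : V => (⟨e (.inl v), by simp⟩ :
      {x // x ∈ Finset.univ.image fun v => e (.inl v)}))
    ⟨fun v w h => by simpa using h, fun ⟨x, hx⟩ => by simpa using hx⟩).symm.trans
  (Equiv.ofBijective (fun v : V => (⟨e (.inr v), by simp⟩ :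
      {x // x ∈ Finset.univ.image fun v => e (.inr v)}))
    ⟨fun v w h => by simpa using h, fun ⟨x, hx⟩ => by simpa using hx⟩)

theorem treeContraction_apply (e : V ⊕ V ≃ E) (v : V)
    (hv : e (.inl v) ∈ Finset.univ.image fun v => e (.inl v)) :
    (treeContraction e ⟨e (.inl v), hv⟩ : E) = e (.inr v) := by
  have : (Equiv.ofBijective (fun v : V => (⟨e (.inl v), by simp⟩ :
      {x // x ∈ Finset.univ.image fun v => e (.inl v)}))
    ⟨fun v w h => by simpa using h, fun ⟨x, hx⟩ => by simpa using hx⟩).symm ⟨e (.inl v), hv⟩ = v := by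
    rw [Equiv.symm_apply_eq]
    rfl
  rw [treeContraction, Equiv.trans_apply, this]
  rfl

/-- The diagram of a parent map with exactly one root. -/
noncomputable def treeDiagram (e : V ⊕ V ≃ E) (f : V → Option V) (r : V)
    (hr : ∀ v, f v = none ↔ v = r) : FeynmanDiagram (Fin 1) (Fin 0) E where
  uBar := Finset.univ.image fun v => e (.inl v)
  u := Finset.univ.image fun v => e (.inr v)
  int := Finset.univ.filter fun x => cellOf e f x ≠ none
  ext := cellFinset e f none
  vertices := Finset.univ.image fun v => cellFinset e f (some v)
  rhoU _ := e (.inr r)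
  rhoUBar := Fin.elim0
  disjoint_uBar_u := by
    rw [Finset.disjoint_left]
    intro x hx hx'
    simp only [Finset.mem_image, Finset.mem_univ, true_and] at hx hx'
    obtain ⟨v, rfl⟩ := hx
    obtain ⟨w, hw⟩ := hx'
    simp at hw
  union_uBar_u := by
    refine Finset.eq_univ_of_forall fun x => ?_
    obtain ⟨v | v, rfl⟩ := e.surjective x <;> simp
  disjoint_int_ext := by
    rw [Finset.disjoint_left]
    simp
  union_int_ext := by
    refine Finset.eq_univ_of_forall fun x => ?_
    simp [or_comm, em]
  bijOn_rhoU := by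
    refine ⟨fun _ _ => ?_, fun _ _ _ _ _ => Subsingleton.elim _ _, fun x hx => ⟨0, trivial, ?_⟩⟩
    · simp [(hr r).2 rfl]
    · simp only [Finset.coe_inter, Set.mem_inter_iff, Finset.mem_coe, Finset.mem_image,
        Finset.mem_univ, true_and, mem_cellFinset] at hx
      obtain ⟨h, v, rfl⟩ := hx
      rw [cellOf_inr, hr] at h
      rw [h]
  bijOn_rhoUBar := by
    refine ⟨fun j => j.elim0, fun j => j.elim0, fun x hx => ?_⟩
    simp only [Finset.coe_inter, Set.mem_inter_iff, Finset.mem_coe, Finset.mem_image,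
      Finset.mem_univ, true_and, mem_cellFinset] at hx
    obtain ⟨h, v, rfl⟩ := hx
    simp at h
  empty_notMem_vertices := by
    simp only [Finset.mem_image, Finset.mem_univ, true_and, not_exists]
    intro v hv
    have : e (.inl v) ∈ cellFinset e f (some v) := by simp
    simp [hv] at this
  pairwiseDisjoint_vertices := by
    intro a ha b hb hab
    simp only [Finset.coe_image, Finset.coe_univ, Set.image_univ, Set.mem_range] at ha hb
    obtain ⟨v, rfl⟩ := ha
    obtain ⟨w, rfl⟩ := hb
    rw [Function.onFun, Finset.disjoint_left]
    intro x hx hx'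
    simp only [id, mem_cellFinset] at hx hx'
    exact hab (by rw [← hx, ← hx'])
  sup_vertices := by
    ext x
    simp only [Finset.mem_sup, Finset.mem_image, Finset.mem_univ, true_and, id,
      exists_exists_eq_and, mem_cellFinset, Finset.mem_filter, Option.ne_none_iff_exists']
  card_vertex_uBar := by
    intro B hB
    simp only [Finset.mem_image, Finset.mem_univ, true_and] at hB
    obtain ⟨v, rfl⟩ := hB
    rw [Finset.card_eq_one]
    refine ⟨e (.inl v), ?_⟩
    ext x
    obtain ⟨w | w, rfl⟩ := e.surjective x <;> simp [eq_comm]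
  contraction := treeContraction e

section

variable {e : V ⊕ V ≃ E} {f : V → Option V} {r : V} {hr : ∀ v, f v = none ↔ v = r}

theorem inl_mem_treeDiagram_uBar (v : V) : e (.inl v) ∈ (treeDiagram e f r hr).uBar := by
  simp [treeDiagram]

theorem treeDiagram_contraction_apply (v : V) (hv : e (.inl v) ∈ (treeDiagram e f r hr).uBar) :
    ((treeDiagram e f r hr).contraction ⟨e (.inl v), hv⟩ : E) = e (.inr v) :=
  treeContraction_apply e v hv

theorem cellFinset_injective (hr : ∀ v, f v = none ↔ v = r) :
    Function.Injective (cellFinset e f) := by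
  intro o o' h
  have key : ∀ o, ∃ x, cellOf e f x = o := fun o => by
    cases o with
    | none => exact ⟨e (.inr r), by simp [(hr r).2 rfl]⟩
    | some v => exact ⟨e (.inl v), by simp⟩
  obtain ⟨x, rfl⟩ := key o
  have : x ∈ cellFinset e f o' := by rw [← h]; simp
  simpa using this

theorem treeDiagram_cells :
    (treeDiagram e f r hr).cells = Finset.univ.image (cellFinset e f) := by
  have hext : cellFinset e f none = {e (.inr r)} := by
    ext x
    obtain ⟨w | w, rfl⟩ := e.surjective x <;> simp [hr]
  ext B
  simp only [FeynmanDiagram.cells, treeDiagram, hext, Finset.mem_union, Finset.mem_image,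
    Finset.mem_univ, true_and, Finset.mem_singleton, exists_eq_left]
  rw [or_comm]
  constructor
  · rintro (h | ⟨v, h⟩)
    · exact ⟨none, hext.trans h⟩
    · exact ⟨some v, h⟩
  · rintro ⟨_ | v, h⟩
    · exact Or.inl (hext.symm.trans h)
    · exact Or.inr ⟨v, h⟩

/-- The cells of the diagram of a parent map. -/
def treeCell (e : V ⊕ V ≃ E) (f : V → Option V) (r : V) (hr : ∀ v, f v = none ↔ v = r)
    (o : Option V) : {c // c ∈ (treeDiagram e f r hr).cells} :=
  ⟨cellFinset e f o, by simp [treeDiagram_cells]⟩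

theorem treeCell_surjective : Function.Surjective (treeCell e f r hr) := by
  rintro ⟨B, hB⟩
  have := hB
  simp only [treeDiagram_cells, Finset.mem_image, Finset.mem_univ, true_and] at this
  obtain ⟨o, rfl⟩ := this
  exact ⟨o, rfl⟩

theorem treeCell_injective : Function.Injective (treeCell e f r hr) := fun _ _ h =>
  cellFinset_injective hr (congrArg Subtype.val h)

theorem treeDiagram_link_iff (o o' : Option V) :
    (treeDiagram e f r hr).Link (treeCell e f r hr o) (treeCell e f r hr o') ↔
      ∃ v, o = some v ∧ f v = o' := by
  constructor
  · rintro ⟨⟨x, hx⟩, h, h'⟩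
    have hx' := hx
    simp only [treeDiagram, Finset.mem_image, Finset.mem_univ, true_and] at hx'
    obtain ⟨v, rfl⟩ := hx'
    rw [treeDiagram_contraction_apply] at h'
    simp only [treeCell, mem_cellFinset, cellOf_inl, cellOf_inr] at h h'
    exact ⟨v, h.symm, h'⟩
  · rintro ⟨v, rfl, rfl⟩
    refine ⟨⟨e (.inl v), inl_mem_treeDiagram_uBar v⟩, ?_, ?_⟩
    · simp [treeCell]
    · rw [treeDiagram_contraction_apply]
      simp [treeCell]

/-- Links join a vertex to its parent. Along a path from the root, accessibility passes both ways:
to the parent of an accessible vertex, and to a vertex whose only predecessor, its parent, is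
accessible. Conversely, well-founded induction climbs from any vertex to the root. -/
theorem treeDiagram_connected_iff : (treeDiagram e f r hr).Connected ↔ IsForest f := by
  constructor
  · intro h
    refine ⟨fun v => ?_⟩
    have hreach := h.preconnected (treeCell e f r hr none) (treeCell e f r hr (some v))
    rw [SimpleGraph.reachable_iff_reflTransGen] at hreach
    suffices ∀ c, Relation.ReflTransGen
        (SimpleGraph.fromRel (treeDiagram e f r hr).Link).Adj (treeCell e f r hr none) c →
        ∀ v, c = treeCell e f r hr (some v) → Acc (fun w v => f v = some w) v from
      this _ hreach v rfl
    intro c hc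
    induction hc with
    | refl =>
      intro v hv
      simpa using treeCell_injective hv
    | @tail b c _ hbc ih =>
      rintro v rfl
      obtain ⟨o, rfl⟩ := treeCell_surjective b
      rw [SimpleGraph.fromRel_adj, treeDiagram_link_iff, treeDiagram_link_iff] at hbc
      obtain ⟨-, ⟨w, rfl, hw⟩ | ⟨w, hw, rfl⟩⟩ := hbc
      · exact (ih w rfl).inv hw
      · obtain rfl := Option.some.inj hw
        exact ⟨_, fun y hy => ih y (by rw [hy])⟩
  · intro h
    have key : ∀ o, (SimpleGraph.fromRel (treeDiagram e f r hr).Link).Reachable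
        (treeCell e f r hr o) (treeCell e f r hr none) := by
      intro o
      cases o with
      | none => exact SimpleGraph.Reachable.refl _
      | some v =>
        induction v using h.induction with
        | _ v ih =>
          have hadj : (SimpleGraph.fromRel (treeDiagram e f r hr).Link).Adj
              (treeCell e f r hr (some v)) (treeCell e f r hr (f v)) := by
            rw [SimpleGraph.fromRel_adj, treeDiagram_link_iff]
            refine ⟨fun heq => ?_, Or.inl ⟨v, rfl, rfl⟩⟩
            -- `SimpleGraph.fromRel` discards loops, so a vertex must be shown to differ from its
            -- parent.
            have := (treeCell_injective heq).symm
            exact h.asymmetric v v this this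
          refine hadj.reachable.trans ?_
          cases hv : f v with
          | none => exact SimpleGraph.Reachable.refl _
          | some w => exact ih w hv
    have : Nonempty {c // c ∈ (treeDiagram e f r hr).cells} := ⟨treeCell e f r hr none⟩
    refine ⟨fun a b => ?_⟩
    obtain ⟨o, rfl⟩ := treeCell_surjective a
    obtain ⟨o', rfl⟩ := treeCell_surjective b
    exact (key o).trans (key o').symm

end

/-- An isomorphism is determined by its action π on the `ū` half-lines: the contraction dictates the
images of the `u` half-lines, and preservation of the vertices says that π transports the parent
map. -/
theorem isIso_treeDiagram_iff {e : V ⊕ V ≃ E} {f : V → Option V} {r : V}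
    {hr : ∀ v, f v = none ↔ v = r} {e' : W ⊕ W ≃ E'} {g : W → Option W} {s : W}
    {hs : ∀ v, g v = none ↔ v = s} (σ : E ≃ E') :
    FeynmanDiagram.IsIso σ (treeDiagram e f r hr) (treeDiagram e' g s hs) ↔
      ∃ π : V ≃ W, conjMap π f = g ∧ σ = e.symm.trans ((Equiv.sumCongr π π).trans e') := by
  constructor
  · intro h
    have h₁ : ∀ v, ∃ w, e' (.inl w) = σ (e (.inl v)) := fun v => by
      have : σ (e (.inl v)) ∈ (treeDiagram e' g s hs).uBar := by
        rw [← h.uBar]; simp [treeDiagram]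
      simpa [treeDiagram] using this
    have h₂ : ∀ w, ∃ v, e (.inl v) = σ.symm (e' (.inl w)) := fun v => by
      have : σ.symm (e' (.inl v)) ∈ (treeDiagram e f r hr).uBar := by
        rw [← h.symm.uBar]; simp [treeDiagram]
      simpa [treeDiagram] using this
    choose π hπ using h₁
    choose π' hπ' using h₂
    have hl : Function.LeftInverse π' π := fun v => by
      have := hπ' (π v)
      rw [hπ] at this
      simpa using this
    have hri : Function.RightInverse π' π := fun v => by
      have := hπ (π' v)
      rw [hπ'] at this
      simpa using this
    have hinr : ∀ v, σ (e (.inr v)) = e' (.inr (π v)) := fun v => by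
      have h₃ := h.contraction (e (.inl v)) (inl_mem_treeDiagram_uBar v)
        (by rw [← hπ]; exact inl_mem_treeDiagram_uBar _)
      rw [treeDiagram_contraction_apply] at h₃
      rw [h₃]
      simp only [← hπ]
      rw [treeDiagram_contraction_apply]
    have hcell : ∀ x, cellOf e' g (σ x) = (cellOf e f x).map π := by
      intro x
      cases hx : cellOf e f x with
      | none =>
        have : σ x ∈ (treeDiagram e' g s hs).ext := by
          rw [← h.ext]; simp [treeDiagram, hx]
        simpa [treeDiagram] using this
      | some v =>
        have : (cellFinset e f (some v)).map σ.toEmbedding ∈ (treeDiagram e' g s hs).vertices := by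
          rw [← h.vertices]
          simp [treeDiagram]
        simp only [treeDiagram, Finset.mem_image, Finset.mem_univ, true_and] at this
        obtain ⟨w, hw⟩ := this
        have hv : σ (e (.inl v)) ∈ cellFinset e' g (some w) := by rw [hw]; simp
        rw [← hπ, mem_cellFinset, cellOf_inl] at hv
        have hx' : σ x ∈ cellFinset e' g (some w) := by rw [hw]; simp [hx]
        rw [mem_cellFinset] at hx'
        rw [hx', Option.map_some, hv]
    refine ⟨⟨π, π', hl, hri⟩, ?_, ?_⟩
    · funext w
      have := hcell (e (.inr (π' w)))
      rw [hinr, cellOf_inr, cellOf_inr, hri] at this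
      exact this.symm
    · ext x
      obtain ⟨v | v, rfl⟩ := e.surjective x
      · simp [hπ]
      · simp [hinr]
  · rintro ⟨π, rfl, rfl⟩
    set σ := e.symm.trans ((Equiv.sumCongr π π).trans e') with hσ
    have hl : ∀ v, σ (e (.inl v)) = e' (.inl (π v)) := fun v => by simp [hσ]
    have hri : ∀ v, σ (e (.inr v)) = e' (.inr (π v)) := fun v => by simp [hσ]
    have hcell : ∀ x, cellOf e' (conjMap π f) (σ x) = (cellOf e f x).map π := by
      intro x
      obtain ⟨v | v, rfl⟩ := e.surjective x
      · simp [hl]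
      · simp [hri, conjMap]
    have hmap : ∀ o, (cellFinset e f o).map σ.toEmbedding =
        cellFinset e' (conjMap π f) (o.map π) := fun o => by
      ext y
      obtain ⟨x, rfl⟩ := σ.surjective y
      simp [hcell, (Option.map_injective π.injective).eq_iff]
    refine ⟨?_, ?_, ?_, ?_, ?_, ?_, ?_, ?_⟩
    · ext y
      rw [Finset.mem_map_equiv]
      obtain ⟨w | w, rfl⟩ := e'.surjective y <;> simp [treeDiagram, hσ]
    · ext y
      rw [Finset.mem_map_equiv]
      obtain ⟨w | w, rfl⟩ := e'.surjective y <;> simp [treeDiagram, hσ]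
    · ext y
      obtain ⟨x, rfl⟩ := σ.surjective y
      simp [treeDiagram, hcell]
    · exact hmap none
    · ext B
      simp only [treeDiagram, Finset.mem_map, Finset.mem_image, Finset.mem_univ, true_and,
        exists_exists_eq_and, π.surjective.exists]
      exact exists_congr fun v => by
        rw [← Option.map_some, ← hmap]
        rfl
    · intro a
      have : π r = s := (hs _).1 (by simp [conjMap, (hr r).2 rfl])
      simp [treeDiagram, hri, this]
    · exact fun b => b.elim0
    · intro x hx hx'
      have hx'' := hx
      simp only [treeDiagram, Finset.mem_image, Finset.mem_univ, true_and] at hx''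
      obtain ⟨v, rfl⟩ := hx''
      rw [treeDiagram_contraction_apply, hri]
      simp only [hl]
      rw [treeDiagram_contraction_apply]

end TreeDiagrams

/-! ### Every diagram comes from a parent map; its amplitude -/

section Classification

set_option linter.unusedSectionVars false

variable {V E : Type*} [Fintype V] [DecidableEq V] [Fintype E] [DecidableEq E]

/-- No `ū` half-line is external and each vertex contains exactly one, so the `ū` half-lines label
the vertices, and through the contraction the `u` half-lines too. The parent of v is the vertex
holding the contracted partner of its `ū` half-line; the root is the v whose partner is external. -/
theorem exists_eq_treeDiagram (D : FeynmanDiagram (Fin 1) (Fin 0) E) :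
    ∃ (N : ℕ) (e : Fin N ⊕ Fin N ≃ E) (f : Fin N → Option (Fin N)) (r : Fin N)
      (hr : ∀ v, f v = none ↔ v = r), D = treeDiagram e f r hr := by
  let l : Fin D.uBar.card ≃ {x // x ∈ D.uBar} := D.uBar.equivFin.symm
  have hu : ∀ x, x ∉ D.uBar → x ∈ D.u := fun x hx => by
    have := Finset.mem_univ x
    rw [← D.union_uBar_u, Finset.mem_union] at this
    exact this.resolve_left hx
  have hext : ∀ x, x ∈ D.ext → x ∉ D.uBar := fun x hx hx' => by
    obtain ⟨j, -⟩ := D.bijOn_rhoUBar.surjOn (by simp [hx, hx'] : x ∈ (↑(D.ext ∩ D.uBar) : Set E))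
    exact j.elim0
  have hint : ∀ x, x ∉ D.ext ↔ ∃ B ∈ D.vertices, x ∈ B := fun x => by
    have h₁ := Finset.mem_univ x
    rw [← D.union_int_ext, Finset.mem_union] at h₁
    have h₂ : x ∈ D.int ↔ ∃ B ∈ D.vertices, x ∈ B := by
      rw [← D.sup_vertices, Finset.mem_sup]; rfl
    rw [← h₂]
    exact ⟨fun h => h₁.resolve_right h, fun h => Finset.disjoint_left.1 D.disjoint_int_ext h⟩
  have hblock : ∀ B ∈ D.vertices, ∀ B' ∈ D.vertices, ∀ x, x ∈ B → x ∈ B' → B = B' :=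
    fun B hB B' hB' x hx hx' => by
      by_contra hne
      exact Finset.disjoint_left.1 (D.pairwiseDisjoint_vertices hB hB' hne) hx hx'
  have hblockU : ∀ B ∈ D.vertices, ∃ v, ∀ w, (l w : E) ∈ B ↔ w = v := fun B hB => by
    obtain ⟨y, hy⟩ := Finset.card_eq_one.1 (D.card_vertex_uBar B hB)
    have hyB : y ∈ B ∩ D.uBar := by rw [hy]; simp
    rw [Finset.mem_inter] at hyB
    refine ⟨l.symm ⟨y, hyB.2⟩, fun w => ?_⟩
    rw [Equiv.eq_symm_apply]
    constructor
    · intro h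
      have : (l w : E) ∈ B ∩ D.uBar := Finset.mem_inter.2 ⟨h, (l w).2⟩
      rw [hy, Finset.mem_singleton] at this
      exact Subtype.ext this
    · intro h
      rw [h]
      exact hyB.1
  let e : Fin D.uBar.card ⊕ Fin D.uBar.card ≃ E := Equiv.ofBijective
    (Sum.elim (fun v => (l v : E)) fun v => (D.contraction (l v) : E)) (by
      have hdis : ∀ v w, (l v : E) ≠ D.contraction (l w) := fun v w h =>
        Finset.disjoint_left.1 D.disjoint_uBar_u (l v).2 (h ▸ (D.contraction (l w)).2)
      constructor
      · rintro (v | v) (w | w) h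
        · simpa [Subtype.ext_iff] using h
        · exact absurd h (hdis v w)
        · exact absurd h.symm (hdis w v)
        · simpa [← Subtype.ext_iff] using h
      · intro x
        by_cases hx : x ∈ D.uBar
        · exact ⟨.inl (l.symm ⟨x, hx⟩), by simp⟩
        · exact ⟨.inr (l.symm (D.contraction.symm ⟨x, hu x hx⟩)), by simp⟩)
  have hl : ∀ v, e (.inl v) = l v := fun _ => rfl
  have hri : ∀ v, e (.inr v) = D.contraction (l v) := fun _ => rfl
  have hcell : ∀ x, ∃ o : Option (Fin D.uBar.card), (o = none ↔ x ∈ D.ext) ∧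
      ∀ v, o = some v ↔ ∃ B ∈ D.vertices, x ∈ B ∧ (l v : E) ∈ B := fun x => by
    by_cases hx : x ∈ D.ext
    · refine ⟨none, by simp [hx], fun v => ⟨fun h => by simp at h, ?_⟩⟩
      rintro ⟨B, hB, hxB, -⟩
      exact absurd hx ((hint x).2 ⟨B, hB, hxB⟩)
    · obtain ⟨B, hB, hxB⟩ := (hint x).1 hx
      obtain ⟨v, hv⟩ := hblockU B hB
      refine ⟨some v, by simp [hx], fun w => ?_⟩
      rw [Option.some_inj]
      constructor
      · rintro rfl
        exact ⟨B, hB, hxB, (hv _).2 rfl⟩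
      · rintro ⟨B', hB', hxB', hw⟩
        obtain rfl := hblock B hB B' hB' x hxB hxB'
        exact ((hv w).1 hw).symm
  choose cell hcell₁ hcell₂ using hcell
  have hroot : D.rhoU 0 ∈ D.ext ∩ D.u := D.bijOn_rhoU.mapsTo (Set.mem_univ 0)
  rw [Finset.mem_inter] at hroot
  let f : Fin D.uBar.card → Option (Fin D.uBar.card) := fun v => cell (e (.inr v))
  let r : Fin D.uBar.card := l.symm (D.contraction.symm ⟨D.rhoU 0, hroot.2⟩)
  have her : e (.inr r) = D.rhoU 0 := by simp [hri, r]
  have hr : ∀ v, f v = none ↔ v = r := fun v => by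
    rw [hcell₁]
    constructor
    · intro h
      have : e (.inr v) ∈ (↑(D.ext ∩ D.u) : Set E) := by
        rw [Finset.mem_coe, Finset.mem_inter]
        exact ⟨h, (D.contraction (l v)).2⟩
      obtain ⟨a, -, ha⟩ := D.bijOn_rhoU.surjOn this
      rw [Subsingleton.elim a 0, ← her] at ha
      simpa using ha.symm
    · rintro rfl
      rw [her]
      exact hroot.1
  have hinl : ∀ v, cell (e (.inl v)) = some v := fun v => by
    have : e (.inl v) ∉ D.ext := fun h => hext _ h (l v).2
    obtain ⟨B, hB, hv⟩ := (hint _).1 this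
    exact (hcell₂ _ _).2 ⟨B, hB, hv, hv⟩
  have hcellOf : ∀ x, cellOf e f x = cell x := fun x => by
    obtain ⟨v | v, rfl⟩ := e.surjective x
    · rw [cellOf_inl, hinl]
    · rw [cellOf_inr]
  have hblockEq : ∀ B ∈ D.vertices, ∀ v, (l v : E) ∈ B → cellFinset e f (some v) = B :=
    fun B hB v hv => by
      ext x
      rw [mem_cellFinset, hcellOf, hcell₂]
      constructor
      · rintro ⟨B', hB', hx, hv'⟩
        rwa [hblock B hB B' hB' _ hv hv']
      · exact fun hx => ⟨B, hB, hx, hv⟩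
  refine ⟨_, e, f, r, hr, FeynmanDiagram.eq_of_isIso_refl ⟨?_, ?_, ?_, ?_, ?_, ?_, ?_, ?_⟩⟩
  · refine Finset.map_refl.trans ?_
    ext x
    simp only [treeDiagram, Finset.mem_image, Finset.mem_univ, true_and, hl]
    exact ⟨fun h => ⟨l.symm ⟨x, h⟩, by simp⟩, by rintro ⟨v, rfl⟩; exact (l v).2⟩
  · refine Finset.map_refl.trans ?_
    ext x
    simp only [treeDiagram, Finset.mem_image, Finset.mem_univ, true_and, hri]
    exact ⟨fun h => ⟨l.symm (D.contraction.symm ⟨x, h⟩), by simp⟩,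
      by rintro ⟨v, rfl⟩; exact (D.contraction (l v)).2⟩
  · refine Finset.map_refl.trans ?_
    ext x
    simp only [treeDiagram, Finset.mem_filter, Finset.mem_univ, true_and, hcellOf, ne_eq, hcell₁,
      hint]
    rw [← D.sup_vertices, Finset.mem_sup]
    rfl
  · refine Finset.map_refl.trans ?_
    ext x
    simp only [treeDiagram, mem_cellFinset, hcellOf, hcell₁]
  · have hv : Finset.mapEmbedding (Equiv.refl E).toEmbedding = RelEmbedding.refl _ := by
      ext s x; simp
    rw [hv]
    refine Finset.map_refl.trans ?_
    ext B
    simp only [treeDiagram, Finset.mem_image, Finset.mem_univ, true_and]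
    constructor
    · intro hB
      obtain ⟨v, hv⟩ := hblockU B hB
      exact ⟨v, hblockEq B hB v ((hv v).2 rfl)⟩
    · rintro ⟨v, rfl⟩
      obtain ⟨B, hB, h, -⟩ := (hcell₂ _ _).1 (hinl v)
      rw [hblockEq B hB v h]
      exact hB
  · intro a
    rw [Subsingleton.elim a 0]
    exact her.symm
  · exact fun b => b.elim0
  · intro x hx hx'
    obtain ⟨v, hv⟩ := l.surjective ⟨x, hx⟩
    obtain rfl : e (.inl v) = x := by rw [hl, hv]
    refine Eq.trans ?_ (treeDiagram_contraction_apply v hx').symm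
    rw [hri, hv]
    rfl

variable {R : Type*} [CommRing R] {n : ℕ}

theorem treeDiagram_vertexFactor (e : V ⊕ V ≃ E) (f : V → Option V) (r : V)
    (hr : ∀ v, f v = none ↔ v = r) (G : Fin n → MvPowerSeries (Fin n) R) (β : V → Fin n) (v : V) :
    (treeDiagram e f r hr).vertexFactor G (fun x => Sum.elim β β (e.symm x))
      (cellFinset e f (some v)) =
      X (β v) * C (tensorCoeff G (β v) (fiberType f β (some v))) := by
  have h₁ : cellFinset e f (some v) ∩ (treeDiagram e f r hr).uBar = {e (.inl v)} := by
    ext x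
    obtain ⟨w | w, rfl⟩ := e.surjective x <;> simp [treeDiagram]
  have h₂ : cellFinset e f (some v) ∩ (treeDiagram e f r hr).u =
      (Finset.univ.filter fun w => f w = some v).map
        ((Function.Embedding.inr : V ↪ V ⊕ V).trans e.toEmbedding) := by
    ext x
    obtain ⟨w | w, rfl⟩ := e.surjective x <;> simp [treeDiagram]
  rw [FeynmanDiagram.vertexFactor, h₁, h₂, Finset.prod_singleton]
  simp [tensorElement, tensorCoeff, fiberType]

/-- The Kronecker symbols force equal indices on contracted half-lines, so an index attribution
reduces to one index per vertex. -/
theorem treeDiagram_amplitude (e : V ⊕ V ≃ E) (f : V → Option V) (r : V)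
    (hr : ∀ v, f v = none ↔ v = r) (G : Fin n → MvPowerSeries (Fin n) R) (i : Fin n) :
    (treeDiagram e f r hr).amplitude G (fun _ => i) Fin.elim0 =
      ∑ β : V → Fin n with β r = i, monomial (totalType β) (forestWeight G f β) := by
  classical
  have hterm : ∀ β : V → Fin n, monomial (totalType β) (forestWeight G f β) =
      ∏ B ∈ (treeDiagram e f r hr).vertices,
        (treeDiagram e f r hr).vertexFactor G (fun x => Sum.elim β β (e.symm x)) B := fun β => by
    have : (treeDiagram e f r hr).vertices = Finset.univ.image fun v => cellFinset e f (some v) :=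
      rfl
    rw [this, Finset.prod_image fun v _ w _ h => by simpa using cellFinset_injective hr h]
    simp only [treeDiagram_vertexFactor]
    rw [Finset.prod_mul_distrib, ← map_prod]
    simp only [X, prod_monomial, Finset.prod_const_one]
    rw [mul_comm, ← smul_eq_C_mul, ← map_smul, smul_eq_mul, mul_one]
    rfl
  simp only [hterm]
  rw [FeynmanDiagram.amplitude]
  have hδ : ∀ α : E → Fin n, (∏ x : {x // x ∈ (treeDiagram e f r hr).uBar},
      if α ((treeDiagram e f r hr).contraction x) = α x then (1 : MvPowerSeries (Fin n) R) else 0) =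
      if ∀ v, α (e (.inr v)) = α (e (.inl v)) then 1 else 0 := fun α => by
    split_ifs with h
    · refine Finset.prod_eq_one fun x _ => if_pos ?_
      obtain ⟨x, hx⟩ := x
      have hx' := hx
      simp only [treeDiagram, Finset.mem_image, Finset.mem_univ, true_and] at hx'
      obtain ⟨v, rfl⟩ := hx'
      rw [treeDiagram_contraction_apply]
      exact h v
    · obtain ⟨v, hv⟩ := not_forall.1 h
      refine Finset.prod_eq_zero (Finset.mem_univ ⟨e (.inl v), inl_mem_treeDiagram_uBar v⟩) ?_
      rw [if_neg]
      rwa [treeDiagram_contraction_apply]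
  simp only [hδ, ite_mul, one_mul, zero_mul]
  rw [← Finset.sum_filter, Finset.filter_filter]
  have hα : ∀ α : E → Fin n, (∀ v, α (e (.inr v)) = α (e (.inl v))) →
      (fun x => Sum.elim (fun v => α (e (.inl v))) (fun v => α (e (.inl v))) (e.symm x)) = α := by
    intro α h
    funext x
    obtain ⟨v | v, rfl⟩ := e.surjective x
    · simp
    · simp [h]
  refine Finset.sum_nbij' (fun α v => α (e (.inl v))) (fun β x => Sum.elim β β (e.symm x))
    (fun α h => ?_) (fun β h => ?_) (fun α h => ?_) (fun β _ => by simp) (fun α h => ?_)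
  · simp only [Finset.mem_filter, Finset.mem_univ, true_and] at h ⊢
    rw [← h.2 r]
    exact h.1.1 0
  · simp only [Finset.mem_filter, Finset.mem_univ, true_and] at h ⊢
    exact ⟨⟨fun _ => by simpa [treeDiagram] using h, fun b => b.elim0⟩, by simp⟩
  · exact hα α (Finset.mem_filter.1 h).2.2
  · rw [hα α (Finset.mem_filter.1 h).2.2]

/-- A forest with exactly one root. -/
def IsTree (f : V → Option V) : Prop := IsForest f ∧ ∃ r, ∀ v, f v = none ↔ v = r

theorem coeff_treeDiagram_amplitude (e : V ⊕ V ≃ E) {f : V → Option V} (hf : IsForest f) (r : V)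
    (hr : ∀ v, f v = none ↔ v = r) (G : Fin n → MvPowerSeries (Fin n) R) (i : Fin n)
    (c : Fin n →₀ ℕ) :
    coeff c ((treeDiagram e f r hr).amplitude G (fun _ => i) Fin.elim0) =
      ∑ β, forestTerm G c (Finsupp.single i 1) f β := by
  classical
  rw [treeDiagram_amplitude, map_sum, Finset.sum_filter]
  refine Finset.sum_congr rfl fun β _ => ?_
  have : fiberType f β none = Finsupp.single (β r) 1 := by
    simp [fiberType, hr, Finset.filter_eq']
  rw [forestTerm, this, coeff_monomial, ← ite_and]
  refine if_congr ?_ rfl rfl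
  rw [Finsupp.single_left_inj one_ne_zero]
  exact ⟨fun h => ⟨hf, h.2.symm, h.1⟩, fun h => ⟨h.2.2, h.2.1.symm⟩⟩

theorem degree_totalType (β : V → Fin n) : (totalType β).degree = Fintype.card V := by
  simp [totalType, map_sum]

/-- Root multiplicities of total degree 1 leave only the forests with one root. -/
theorem forestSum_single_eq (G : Fin n → MvPowerSeries (Fin n) R) (i : Fin n) (c : Fin n →₀ ℕ)
    [Fintype {f : V → Option V // IsTree f}] :
    forestSum V G c (Finsupp.single i 1) =
      ∑ f : {f : V → Option V // IsTree f}, ∑ β, forestTerm G c (Finsupp.single i 1) f.1 β := by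
  classical
  rw [← Finset.sum_subtype (Finset.univ.filter fun f : V → Option V => IsTree f) (by simp)
    (fun f => ∑ β, forestTerm G c (Finsupp.single i 1) f β), forestSum]
  refine (Finset.sum_filter_of_ne fun f _ hne => ?_).symm
  obtain ⟨β, -, hβ⟩ := Finset.exists_ne_zero_of_sum_ne_zero hne
  obtain ⟨hf, -, h⟩ : IsForest f ∧ totalType β = c ∧ fiberType f β none = Finsupp.single i 1 := by
    by_contra h
    exact hβ (if_neg h)
  refine ⟨hf, ?_⟩
  have hcard : (Finset.univ.filter fun v => f v = none).card = 1 := by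
    have := congrArg Finsupp.degree h
    simpa [fiberType, map_sum] using this
  obtain ⟨r, hr⟩ := Finset.card_eq_one.1 hcard
  refine ⟨r, fun v => ?_⟩
  have := Finset.ext_iff.1 hr v
  simpa using this

end Classification

/-! ### From isomorphism classes to labelled trees -/

section OnePoint

set_option linter.unusedSectionVars false

variable {V E : Type*} [Fintype V] [DecidableEq V] [Fintype E] [DecidableEq E]

noncomputable instance fintypeIsTree : Fintype {f : V → Option V // IsTree f} :=
  Fintype.ofFinite _

theorem isTree_conjMap (e : V ≃ V) {f : V → Option V} (hf : IsTree f) : IsTree (conjMap e f) := by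
  obtain ⟨h, r, hr⟩ := hf
  refine ⟨isForest_conjMap e h, e r, fun v => ?_⟩
  simp [conjMap, hr, Equiv.symm_apply_eq]

theorem card_aut_treeDiagram (e : V ⊕ V ≃ E) (f : V → Option V) (r : V)
    (hr : ∀ v, f v = none ↔ v = r) :
    Nat.card (treeDiagram e f r hr).Aut = Nat.card {π : Equiv.Perm V // conjMap π f = f} := by
  refine (Nat.card_congr (Equiv.ofBijective
    (fun π : {π : Equiv.Perm V // conjMap π f = f} =>
      (⟨e.symm.trans ((Equiv.sumCongr π.1 π.1).trans e),
        (isIso_treeDiagram_iff _).2 ⟨π.1, π.2, rfl⟩⟩ : (treeDiagram e f r hr).Aut))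
    ⟨fun π π' h => ?_, fun ⟨σ, hσ⟩ => ?_⟩)).symm
  · ext v
    have := DFunLike.congr_fun (congrArg Subtype.val h) (e (.inl v))
    simpa using this
  · obtain ⟨π, hπ, rfl⟩ := (isIso_treeDiagram_iff _).1 hσ
    exact ⟨⟨π, hπ⟩, rfl⟩

/-- The trees with vertices in `Fin N`. -/
abbrev TreeOn (N : ℕ) := {f : Fin N → Option (Fin N) // IsTree f}

variable {N : ℕ}

/-- The diagram of a tree on `Fin N`. -/
noncomputable def diagramOfTree (f : TreeOn N) :
    FeynmanDiagram (Fin 1) (Fin 0) (Fin (N + N)) :=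
  treeDiagram finSumFinEquiv f.1 f.2.2.choose f.2.2.choose_spec

/-- The class of the diagram of a tree on `Fin N`. -/
noncomputable def treeClass (f : TreeOn N) :
    DiagramClass (Fin 1) (Fin 0) :=
  Quotient.mk _ ⟨N + N, diagramOfTree f, treeDiagram_connected_iff.2 f.2.1⟩

theorem treeClass_eq_iff (f g : TreeOn N) :
    treeClass f = treeClass g ↔ ∃ π : Equiv.Perm (Fin N), conjMap π f.1 = g.1 := by
  rw [treeClass, treeClass, Quotient.eq]
  constructor
  · rintro ⟨σ, hσ⟩
    obtain ⟨π, hπ, -⟩ := (isIso_treeDiagram_iff (hr := f.2.2.choose_spec)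
      (hs := g.2.2.choose_spec) σ).1 hσ
    exact ⟨π, hπ⟩
  · rintro ⟨π, hπ⟩
    exact ⟨_, (isIso_treeDiagram_iff (hr := f.2.2.choose_spec) (hs := g.2.2.choose_spec) _).2
      ⟨π, hπ, rfl⟩⟩

theorem exists_treeClass_eq (q : DiagramClass (Fin 1) (Fin 0)) :
    ∃ (N : ℕ) (f : TreeOn N), treeClass f = q := by
  induction q using Quotient.inductionOn with
  | _ D =>
    obtain ⟨k, D, hD⟩ := D
    obtain ⟨N, e, f, r, hr, rfl⟩ := exists_eq_treeDiagram D
    have hf : IsTree f := ⟨treeDiagram_connected_iff.1 hD, r, hr⟩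
    refine ⟨N, ⟨f, hf⟩, Quotient.sound ?_⟩
    exact ⟨_, (isIso_treeDiagram_iff (hr := hf.2.choose_spec) (hs := hr) _).2
      ⟨Equiv.refl _, by ext1 v; simp [conjMap], rfl⟩⟩

-- Orbit-stabilizer for the symmetric group acting on labelled trees: the orbits are the isomorphism
-- classes and the stabilizers are the automorphism groups.
open Classical in
theorem card_treeClass_fiber (f : TreeOn N) :
    (Finset.univ.filter fun g : TreeOn N => treeClass g = treeClass f).card *
      Nat.card (diagramOfTree f).Aut = N.factorial := by
  rw [diagramOfTree, card_aut_treeDiagram]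
  have h₀ := Finset.card_eq_sum_card_fiberwise (s := (Finset.univ : Finset (Equiv.Perm (Fin N))))
    (f := fun π => (⟨conjMap π f.1, isTree_conjMap π f.2⟩ :
      TreeOn N))
    (t := Finset.univ.filter fun g : TreeOn N => treeClass g = treeClass f) (fun π _ => by
      simp only [Finset.coe_filter, Finset.mem_univ, true_and, Set.mem_ofPred_eq]
      exact ((treeClass_eq_iff _ _).2 ⟨π, rfl⟩).symm)
  rw [Finset.card_univ, Fintype.card_perm, Fintype.card_fin] at h₀
  rw [h₀, Finset.sum_const_nat (m := Nat.card {π : Equiv.Perm (Fin N) // conjMap π f.1 = f.1})]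
  intro g hg
  obtain ⟨π₀, hπ₀⟩ := (treeClass_eq_iff _ _).1 (Finset.mem_filter.1 hg).2.symm
  rw [Nat.card_eq_fintype_card, Fintype.card_subtype]
  have htrans : ∀ π π' : Equiv.Perm (Fin N),
      conjMap (π.trans π') f.1 = conjMap π' (conjMap π f.1) := fun π π' => by
    funext v
    simp [conjMap, Function.comp_def]
  have hinv : conjMap π₀.symm g.1 = f.1 := by
    rw [← hπ₀]
    exact (conjEquiv π₀).left_inv f.1
  -- The permutations carrying f to g form a coset of the stabilizer of f, translated by π₀.
  refine Finset.card_nbij' (fun π => π.trans π₀.symm) (fun π => π.trans π₀) (fun π hπ => ?_)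
    (fun π hπ => ?_) (fun π _ => by ext; simp) (fun π _ => by ext; simp)
  · simp only [Finset.coe_filter, Finset.mem_univ, true_and, Set.mem_ofPred_eq,
      Subtype.ext_iff] at hπ ⊢
    rw [htrans, hπ, hinv]
  · simp only [Finset.coe_filter, Finset.mem_univ, true_and, Set.mem_ofPred_eq,
      Subtype.ext_iff] at hπ ⊢
    rw [htrans, hπ, hπ₀]

variable {R : Type*} [CommRing R] [Algebra ℚ R] {n : ℕ}

theorem coeff_onePointWeight_treeClass (G : Fin n → MvPowerSeries (Fin n) R) (i : Fin n)
    (c : Fin n →₀ ℕ) (f : TreeOn N) :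
    coeff c (onePointWeight G i (treeClass f)) = ((Nat.card (diagramOfTree f).Aut : ℚ)⁻¹) •
      ∑ β, forestTerm G c (Finsupp.single i 1) f.1 β := by
  rw [← coeff_treeDiagram_amplitude finSumFinEquiv f.2.1 f.2.2.choose f.2.2.choose_spec]
  rfl

-- Each vertex contributes one factor X, so only trees on |c| vertices reach the monomial X^c, and
-- they are finitely many.
open Classical in
theorem support_coeff_onePointWeight (G : Fin n → MvPowerSeries (Fin n) R) (i : Fin n)
    (c : Fin n →₀ ℕ) : {q | coeff c (onePointWeight G i q) ≠ 0} ⊆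
      ((Finset.univ : Finset (TreeOn c.degree)).image
        treeClass : Set (DiagramClass (Fin 1) (Fin 0))) := by
  intro q hq
  obtain ⟨N, f, rfl⟩ := exists_treeClass_eq q
  rw [Set.mem_ofPred_eq, coeff_onePointWeight_treeClass] at hq
  obtain ⟨β, -, hβ⟩ := Finset.exists_ne_zero_of_sum_ne_zero (right_ne_zero_of_smul hq)
  have hc : totalType β = c := by
    by_contra h
    exact hβ (if_neg fun h' => h h'.2.1)
  have hN : N = c.degree := by rw [← hc, degree_totalType, Fintype.card_fin]
  subst hN
  simp

theorem summableFamily_onePointWeight (G : Fin n → MvPowerSeries (Fin n) R) (i : Fin n) :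
    SummableFamily (onePointWeight G i) := fun c => by
  classical
  exact (Finset.finite_toSet _).subset (support_coeff_onePointWeight G i c)

/-- Group the labelled trees by class: a class consists of N!/#Aut trees with equal contributions,
so dividing by N! leaves the weight 1/#Aut. -/
theorem connectedOnePoint_eq_forestSeries (G : Fin n → MvPowerSeries (Fin n) R) (i : Fin n) :
    connectedOnePoint G i = forestSeries G (Finsupp.single i 1) := by
  classical
  ext c
  change ∑ᶠ q, coeff c (onePointWeight G i q) = _
  rw [finsum_eq_sum_of_support_subset _ (support_coeff_onePointWeight G i c), coeff_forestSeries,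
    forestSum_single_eq]
  have hfac : ∏ j, ((Finsupp.single i 1 : Fin n →₀ ℕ) j).factorial = 1 :=
    Finset.prod_eq_one fun j _ => by
      rw [Finsupp.single_apply]
      split_ifs <;> rfl
  rw [hfac, Finset.mul_sum, ← Finset.sum_fiberwise_of_maps_to
    (fun f _ => Finset.mem_image_of_mem treeClass (Finset.mem_univ f))]
  refine Finset.sum_congr rfl fun q hq => ?_
  obtain ⟨f, -, rfl⟩ := Finset.mem_image.1 hq
  have hterm : ∀ g ∈ Finset.univ.filter (fun g : TreeOn c.degree => treeClass g = treeClass f),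
      algebraMap ℚ R ((1 : ℕ) / (c.degree.factorial : ℚ)) *
        ∑ β, forestTerm G c (Finsupp.single i 1) g.1 β =
      algebraMap ℚ R ((1 : ℕ) / (c.degree.factorial : ℚ)) *
        ∑ β, forestTerm G c (Finsupp.single i 1) f.1 β := fun g hg => by
    obtain ⟨π, hπ⟩ := (treeClass_eq_iff _ _).1 (Finset.mem_filter.1 hg).2
    rw [← hπ]
    congr 1
    exact Fintype.sum_equiv (π.arrowCongr (Equiv.refl _)) _ _ fun β =>
      (forestTerm_conjMap π G c _ g.1 β).symm
  rw [Finset.sum_congr rfl hterm, Finset.sum_const, coeff_onePointWeight_treeClass,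
    Algebra.smul_def, nsmul_eq_mul, ← mul_assoc]
  congr 1
  rw [← map_natCast (algebraMap ℚ R), ← map_mul]
  congr 1
  have hcard := card_treeClass_fiber f
  have h₀ : (c.degree.factorial : ℚ) ≠ 0 := by exact_mod_cast Nat.factorial_ne_zero _
  rw [← hcard] at h₀ ⊢
  push_cast at h₀ ⊢
  obtain ⟨h₁, h₂⟩ := mul_ne_zero_iff.1 h₀
  field_simp

end OnePoint

end LagrangeGood

/-! ### Comparison of the three branching families -/

open LagrangeGood MvPowerSeries in
theorem mainTheorem11 {R : Type*} [CommRing R] [Algebra ℚ R] (n : ℕ)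
    (G : Fin n → MvPowerSeries (Fin n) R) :
    -- the sums over classes of connected diagrams converge in `R[[X]]`
    (∀ i, LagrangeGood.SummableFamily (LagrangeGood.onePointWeight G i)) ∧
    -- `F_i = ⟨u_i⟩_C` has no constant term and solves the implicit equations
    (∀ i, MvPowerSeries.constantCoeff (LagrangeGood.connectedOnePoint G i) = 0) ∧
    (∀ i, LagrangeGood.connectedOnePoint G i =
      MvPowerSeries.X i * (G i).subst (LagrangeGood.connectedOnePoint G)) ∧
    -- it is the only such solution
    (∀ F : Fin n → MvPowerSeries (Fin n) R,
      (∀ i, MvPowerSeries.constantCoeff (F i) = 0) →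
      (∀ i, F i = MvPowerSeries.X i * (G i).subst F) →
      F = LagrangeGood.connectedOnePoint G) ∧
    -- the Gaussian integrals converge, the denominator is invertible, and `F_i` is their ratio
    LagrangeGood.GaussianSummable 1 (LagrangeGood.expInteraction G) ∧
    (∀ i, LagrangeGood.GaussianSummable 1
      (MvPowerSeries.X (LagrangeGood.Var.u i) * LagrangeGood.expInteraction G)) ∧
    IsUnit (LagrangeGood.gaussianIntegral 1 (LagrangeGood.expInteraction G)) ∧
    (∀ i, LagrangeGood.connectedOnePoint G i =
      LagrangeGood.gaussianIntegral 1
          (MvPowerSeries.X (LagrangeGood.Var.u i) * LagrangeGood.expInteraction G) *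
        Ring.inverse (LagrangeGood.gaussianIntegral 1 (LagrangeGood.expInteraction G))) := by
  have hK := isBranching_forestSeries G
  have hK0 := forestSeries_zero G
  have hF : connectedOnePoint G = fun i => forestSeries G (Finsupp.single i 1) :=
    funext (connectedOnePoint_eq_forestSeries G)
  have hL := isBranching_gaussianIntegral G
  have h1 : (monomial (varExp 0 ((0 : Fin n →₀ ℕ) : Fin n → ℕ) 0) 1 : MvPowerSeries (Var n) R) *
      expInteraction G = expInteraction G := by
    have : varExp 0 ((0 : Fin n →₀ ℕ) : Fin n → ℕ) 0 = 0 :=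
      var_finsupp_ext (fun _ => rfl) (fun _ => rfl) (fun _ => rfl)
    rw [this, monomial_zero_one, one_mul]
  have hX : ∀ i, (monomial (varExp 0 (Finsupp.single i 1 : Fin n →₀ ℕ) 0) 1 :
      MvPowerSeries (Var n) R) = X (Var.u i) := fun i => by
    classical
    rw [X]
    congr 1
    refine congrArg _ (var_finsupp_ext (fun j => ?_) (fun j => ?_) (fun j => ?_)) <;>
      simp [Finsupp.single_apply]
  have hunit : IsUnit (gaussianIntegral 1 (expInteraction G)) := by
    -- The constant term of the denominator is [u^0] of an empty product of factors G_i, that is 1.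
    rw [MvPowerSeries.isUnit_iff_constantCoeff, ← coeff_zero_eq_constantCoeff_apply, ← h1,
      coeff_gaussianIntegral]
    simp
  refine ⟨summableFamily_onePointWeight G, fun i => ?_, fun i => ?_, fun F h0 h => ?_, ?_,
    fun i => ?_, hunit, fun i => ?_⟩
  · rw [hF]
    exact hK.constantCoeff_single i
  · rw [hF]
    exact hK.single_eq_X_mul_subst hK0 i
  · funext i
    -- The powers of F have value 1 at exponent 0, so they coincide with the forest series.
    have := (isBranching_of_eq h0 h).eq_mul hK hK0 (Finsupp.single i 1)
    rw [hF]
    simpa using this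
  · rw [← h1]
    exact gaussianSummable_monomial_mul G 0
  · rw [← hX]
    exact gaussianSummable_monomial_mul G _
  -- The numerator equals the denominator times the forest series at e_i.
  · have := hL.eq_mul hK hK0 (Finsupp.single i 1)
    simp only [h1] at this
    rw [← hX, this, mul_comm (gaussianIntegral 1 (expInteraction G)), mul_assoc,
      Ring.mul_inverse_cancel _ hunit, mul_one, connectedOnePoint_eq_forestSeries]
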